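/- Let $k\ge 1$, let $\theta_1\ge\dots\ge\theta_k>0$, let $r_1,\dots,r_k:[0,1]\to\mathbb R$ be Lipschitz functions that are orthonormal in $L^2[0,1]$ (Assumption F2), and suppose that $$f(x,y)=\sum_{l=1}^k\theta_l r_l(x)r_l(y)\ge 0\qquad\text{for all }x,y\in[0,1].$$ Let $(\varepsilon_N)_{N\ge1}$ satisfy $0<\varepsilon_N\le(\sup_{[0,1]^2}f)^{-1}$ for all $N\ge 1$ and, for some $\xi>8$ and some $\varepsilon_\infty\ge0$, $$\lim_{N\to\infty}\frac{(\log N)^\xi}{N\varepsilon_N}=0,\qquad \lim_{N\to\infty}\varepsilon_N=\varepsilon_\infty$$ (Assumption E1). For each $N$ let $A_N$ be a random symmetric $N\times N$ matrix with entries in $\{0,1\}$ whose entries $A_N(a,b)$, $1\le a\le b\le N$, are independent with $P(A_N(a,b)=1)=\varepsilon_N f(a/N,b/N)$, and let $\lambda_1(A_N)\ge\dots\ge\lambda_N(A_N)$ be its eigenvalues, counted with multiplicity. With the conventions $\theta_0=\infty$, $\theta_{k+1}=-\infty$, let $\mathcal I=\{1\le i\le k:\theta_{i-1}>\theta_i>\theta_{i+1}\}$,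 and for $1\le j\le k$ let $e_j=N^{-1/2}\,(r_j(1/N),r_j(2/N),\dots,r_j(1))'\in\mathbb R^N$. Fix $i\in\mathcal I$. Then: 1. $\lim_{N\to\infty}P\big(\lambda_i(A_N)\text{ is an eigenvalue of }A_N\text{ of multiplicity }1\big)=1$. 2. For $N\ge i$ let $v=v_N$ be an eigenvector of $A_N$ of Euclidean norm $1$ corresponding to $\lambda_i(A_N)$ (any choice of such a random vector), with its sign chosen so that $e_i'v\ge 0$. Then $e_i'v=1+O_p\big((N\varepsilon_N)^{-1}\big)$. 3. If $k\ge2$, then for every $j\in\{1,\dots,k\}\setminus\{i\}$, $e_j'v=O_p\big((N\varepsilon_N)^{-1}\big)$ (whichever sign is chosen for $v$). Here $Y_N=O_p(Z_N)$ means $\lim_{x\to\infty}\sup_{N}P(|Y_N|>x|Z_N|)=0$, the supremum being over all $N\ge i$, that is, all $N$ for which $\lambda_i(A_N)$ exists. -/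

import Mathlib

open MeasureTheory ProbabilityTheory Filter Topology Set
open scoped ENNReal

/-- The kernel `f : [0,1]² → [0,∞)` together with its spectral decomposition
`f(x,y) = ∑ i, θ i * r i x * r i y` (everywhere on the square), where
`θ₁ ≥ … ≥ θ_k > 0` and `r₁, …, r_k` are orthonormal in `L²[0,1]`.
The indices `1, …, k` of the mathematics are the elements `0, …, k-1` of `Fin k`.
Functions on `[0,1]` are represented by functions on `ℝ`, only whose values on `[0,1]` matter. -/
structure IsSpectralKernel {k : ℕ} (f : ℝ → ℝ → ℝ) (θ : Fin k → ℝ) (r : Fin k → ℝ → ℝ) :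
    Prop where
  nonneg : ∀ x ∈ Icc (0 : ℝ) 1, ∀ y ∈ Icc (0 : ℝ) 1, 0 ≤ f x y
  decomp : ∀ x ∈ Icc (0 : ℝ) 1, ∀ y ∈ Icc (0 : ℝ) 1, f x y = ∑ i, θ i * r i x * r i y
  antitone : Antitone θ
  pos : ∀ i, 0 < θ i
  memLp : ∀ i, MemLp (r i) 2 (volume.restrict (Icc (0 : ℝ) 1))
  orthonormal : ∀ i j, ∫ x in Icc (0 : ℝ) 1, r i x * r j x = if i = j then 1 else 0

/-- Assumption F2: every eigenfunction is Lipschitz on `[0,1]`. -/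
def AssumptionF2 {k : ℕ} (r : Fin k → ℝ → ℝ) : Prop :=
  ∀ i, ∃ K : ℝ, ∀ x ∈ Icc (0 : ℝ) 1, ∀ y ∈ Icc (0 : ℝ) 1, |r i x - r i y| ≤ K * |x - y|

/-- The standing requirement `0 < ε_N ≤ (sup f)⁻¹` for `N ≥ 1`. -/
def IsAdmissibleScale (f : ℝ → ℝ → ℝ) (ε : ℕ → ℝ) : Prop :=
  ∀ N, 1 ≤ N → 0 < ε N ∧ ε N ≤ (sSup (image2 f (Icc (0 : ℝ) 1) (Icc (0 : ℝ) 1)))⁻¹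

/-- Assumption E1: `(log N)^ξ / (N ε_N) → 0` for some `ξ > 8`, and `ε_N` converges to some
`ε_∞ ≥ 0`. -/
def AssumptionE1 (ε : ℕ → ℝ) : Prop :=
  (∃ ξ : ℝ, 8 < ξ ∧ Tendsto (fun N : ℕ => 1 / (N * ε N) * Real.log N ^ ξ) atTop (𝓝 0)) ∧
    ∃ εlim : ℝ, 0 ≤ εlim ∧ Tendsto ε atTop (𝓝 εlim)

/-- The index `i` belongs to `𝓘`: `θ_{i-1} > θ_i > θ_{i+1}`, where `θ_0 = ∞`, `θ_{k+1} = -∞`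
(so that a comparison with a non-existing neighbour is void). -/
def IsIsolated {k : ℕ} (θ : Fin k → ℝ) (i : Fin k) : Prop :=
  (∀ j : Fin k, (j : ℕ) + 1 = i → θ i < θ j) ∧ (∀ j : Fin k, (j : ℕ) = i + 1 → θ j < θ i)

/-- `M` is the (random) adjacency matrix of the inhomogeneous Erdős–Rényi graph on `N` vertices,
self-loops allowed: it is symmetric, with entries in `{0, 1}`, the entries on and above the
diagonal are independent, and the `(a, b)` entry is Bernoulli with parameter
`ε f(a / N, b / N)`. The vertices `1, …, N` are the elements `0, …, N-1` of `Fin N`. -/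
structure IsInhomERAdjacency {Ω : Type*} [MeasurableSpace Ω] (P : Measure Ω)
    (f : ℝ → ℝ → ℝ) (ε : ℝ) (N : ℕ) (M : Ω → Matrix (Fin N) (Fin N) ℝ) : Prop where
  measurable : ∀ a b, Measurable fun ω => M ω a b
  zero_or_one : ∀ ω a b, M ω a b = 0 ∨ M ω a b = 1
  isHermitian : ∀ ω, (M ω).IsHermitian
  prob_one : ∀ a b : Fin N, a ≤ b →
    P {ω | M ω a b = 1} =
      ENNReal.ofReal (ε * f (((a : ℕ) + 1 : ℝ) / N) (((b : ℕ) + 1 : ℝ) / N))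
  indep : iIndepFun (fun (p : {p : Fin N × Fin N // p.1 ≤ p.2}) ω => M ω p.1.1 p.1.2) P

/-- The eigenvalues `λ₁(M) ≥ … ≥ λ_N(M)` of a real symmetric matrix, listed in decreasing order
with multiplicity. The index `i : Fin N` stands for `λ_{i+1}(M)`. -/
noncomputable def orderedEigenvalue {N : ℕ} {M : Matrix (Fin N) (Fin N) ℝ} (hM : M.IsHermitian)
    (i : Fin N) : ℝ :=
  hM.eigenvalues₀ (Fin.cast (Fintype.card_fin N).symm i)

/-- The real number `μ` is an eigenvalue of multiplicity one of the (symmetric) matrix `M`. -/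
def IsSimpleEigenvalue {N : ℕ} (M : Matrix (Fin N) (Fin N) ℝ) (μ : ℝ) : Prop :=
  Module.finrank ℝ (Module.End.eigenspace (Matrix.toEuclideanLin M) μ) = 1

/-- `w` is an eigenvector of `M` for `μ`, of Euclidean norm one. -/
def IsUnitEigenvector {N : ℕ} (M : Matrix (Fin N) (Fin N) ℝ) (μ : ℝ)
    (w : EuclideanSpace ℝ (Fin N)) : Prop :=
  ‖w‖ = 1 ∧ Matrix.toEuclideanLin M w = μ • w

/-- The vector `N^{-1/2} (g(1/N), g(2/N), …, g(1))`; the vector `e_i` is the one with `g = r i`. -/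
noncomputable def discretize (g : ℝ → ℝ) (N : ℕ) : EuclideanSpace ℝ (Fin N) :=
  WithLp.toLp 2 fun a => (√(N : ℝ))⁻¹ * g (((a : ℕ) + 1 : ℝ) / N)

/-- `Y_N = O_p(Z_N)`, for sequences indexed by `N ≥ n₀`:
`lim_{x → ∞} sup_{N ≥ n₀} P(|Y_N| > x |Z_N|) = 0`. -/
def IsBigOInProb {Ω : Type*} [MeasurableSpace Ω] (P : Measure Ω) (n₀ : ℕ) (Y Z : ℕ → Ω → ℝ) :
    Prop :=
  Tendsto (fun x : ℝ => ⨆ N : ℕ, ⨆ _ : n₀ ≤ N, P {ω | x * |Z N ω| < |Y N ω|}) atTop (𝓝 0)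

/-! Put T = N ε_N. The adjacency matrix is the signal T ∑ θ_l e_l e_l' plus a centred symmetric
noise W with entries independent up to symmetry. The e_l are orthonormal up to O(1/N), because their
Gram matrix consists of Riemann sums of Lipschitz functions. If ‖W‖ ≤ δT with δ small, the minimax
principle puts λ_i within a small multiple of T of Tθ_i. Hence λ_i stays at distance of order T from
every other Tθ_j (`abs_orderedEigenvalue_sub_le`).

The norm bound alone does not give the rate 1/T. It comes from two finer facts about fixed
delocalised vectors, both by Chebyshev: ‖W e_j‖ = O(√T) and e_j'W e_l = O(1). Let λ = λ_i and c_l =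
e_l'v, so that λv = T ∑ θ_l c_l e_l + Wv. Applying W and absorbing W(Wv) on the left gives ‖Wv‖ =
O(√T). Pairing with W e_j then gives e_j'Wv = O(1), and pairing with e_j gives (λ - Tθ_j) c_j =
O(1). The gap yields c_j = O(1/T) for j ≠ i. Pairing with v and with Wv yields λ - Tθ_i c_i² = O(1),
and therefore c_i² - 1 = O(1/T) (`exists_overlap_bound`). Since every unit eigenvector for λ_i then
has a nonzero overlap with e_i, the eigenvalue is simple.

The bound on ‖W‖ is obtained from trace moments without counting walks. Write W = ∑ (x_e - p_e) H_e.
Integration by parts in x_e turns E tr W^(2m+2) into differences of tr H_e W^(2m+1) under a flip of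
one coordinate. Telescoping and a trace inequality between arithmetic and geometric means bound
these by tr H_e² W^(2m) (`IsBernoulliLaw.integral_trace_pow_succ_le`). The matrices H_e² add up to a
diagonal matrix of degrees, which are O(T) outside an exponentially rare event, so each step costs a
factor O(mT). About log N steps and Markov's inequality suffice once (log N)² is small compared with
T. -/

namespace Matrix

/-! ### Trace inequalities for powers of symmetric matrices -/

variable {n : Type*} [Fintype n] [DecidableEq n]

/-- Orthogonal diagonalisation of all powers of a real symmetric matrix. -/
theorem IsHermitian.exists_pow_eq {W : Matrix n n ℝ} (hW : W.IsHermitian) :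
    ∃ U : Matrix n n ℝ, ∀ q : ℕ, W ^ q = U * diagonal (fun j => hW.eigenvalues j ^ q) * Uᵀ := by
  refine ⟨hW.eigenvectorUnitary, fun q => ?_⟩
  have h1 : W ^ q = Unitary.conjStarAlgAut ℝ _ hW.eigenvectorUnitary
      (diagonal (RCLike.ofReal ∘ hW.eigenvalues) ^ q) := by
    rw [map_pow, ← hW.spectral_theorem]
  rw [h1, Unitary.conjStarAlgAut_apply, diagonal_pow]
  congr 1

theorem trace_transpose_mul_diagonal_mul (B : Matrix n n ℝ) (w y : n → ℝ) :
    (Bᵀ * diagonal w * B * diagonal y).trace = ∑ k, ∑ j, B j k ^ 2 * (w j * y k) := by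
  simp only [trace, diag, mul_diagonal]
  refine Finset.sum_congr rfl fun k _ => ?_
  rw [mul_apply, Finset.sum_mul]
  refine Finset.sum_congr rfl fun j _ => ?_
  rw [mul_diagonal, transpose_apply]
  ring

/-- Expansion of `tr (H W^q H Y^s)` in the eigenbases of `W` and `Y`. -/
theorem exists_trace_mul_pow_mul_pow {H W Y : Matrix n n ℝ} (hH : H.IsHermitian)
    (hW : W.IsHermitian) (hY : Y.IsHermitian) :
    ∃ B : Matrix n n ℝ, ∀ q s : ℕ, (H * W ^ q * H * Y ^ s).trace =
      ∑ k, ∑ j, B j k ^ 2 * (hW.eigenvalues j ^ q * hY.eigenvalues k ^ s) := by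
  obtain ⟨U, hU⟩ := hW.exists_pow_eq
  obtain ⟨V, hV⟩ := hY.exists_pow_eq
  have hH' : Hᵀ = H := by simpa [IsHermitian, conjTranspose_eq_transpose_of_trivial] using hH
  -- The squared entries of `H` between the two eigenbases are nonnegative weights, so trace
  -- inequalities reduce to scalar ones.
  refine ⟨Uᵀ * H * V, fun q s => ?_⟩
  rw [← trace_transpose_mul_diagonal_mul (Uᵀ * H * V), hU, hV]
  simp only [transpose_mul, hH', transpose_transpose]
  rw [show H * (U * diagonal (fun j => hW.eigenvalues j ^ q) * Uᵀ) * H *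
      (V * diagonal (fun j => hY.eigenvalues j ^ s) * Vᵀ) =
      (H * U * diagonal (fun j => hW.eigenvalues j ^ q) * Uᵀ * H *
      V * diagonal (fun j => hY.eigenvalues j ^ s)) * Vᵀ by simp only [Matrix.mul_assoc],
    trace_mul_comm]
  simp only [Matrix.mul_assoc]

/-- With q + s = 2m, the difference of the two sides is at least (|w|^q - |y|^q)(|w|^s - |y|^s),
whose factors have the same sign. The even total degree is what lets the right side be written with
absolute values. -/
theorem _root_.pow_mul_pow_add_le (w y : ℝ) (m q : ℕ) (hq : q ≤ 2 * m) :
    w ^ q * y ^ (2 * m - q) + w ^ (2 * m - q) * y ^ q ≤ w ^ (2 * m) + y ^ (2 * m) := by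
  obtain ⟨s, hs⟩ := Nat.exists_eq_add_of_le hq
  have e1 : 2 * m - q = s := by omega
  rw [e1]
  have hw : w ^ (2 * m) = |w| ^ q * |w| ^ s := by
    rw [← pow_add, ← hs, pow_mul, pow_mul, sq_abs]
  have hy : y ^ (2 * m) = |y| ^ q * |y| ^ s := by
    rw [← pow_add, ← hs, pow_mul, pow_mul, sq_abs]
  have h1 : w ^ q * y ^ s ≤ |w| ^ q * |y| ^ s := by
    rw [← abs_pow, ← abs_pow, ← abs_mul]; exact le_abs_self _
  have h2 : w ^ s * y ^ q ≤ |w| ^ s * |y| ^ q := by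
    rw [← abs_pow, ← abs_pow, ← abs_mul]; exact le_abs_self _
  have h3 : 0 ≤ (|w| ^ q - |y| ^ q) * (|w| ^ s - |y| ^ s) := by
    rcases le_total |w| |y| with h | h
    · exact mul_nonneg_of_nonpos_of_nonpos
        (sub_nonpos.2 (pow_le_pow_left₀ (abs_nonneg _) h _))
        (sub_nonpos.2 (pow_le_pow_left₀ (abs_nonneg _) h _))
    · exact mul_nonneg (sub_nonneg.2 (pow_le_pow_left₀ (abs_nonneg _) h _))
        (sub_nonneg.2 (pow_le_pow_left₀ (abs_nonneg _) h _))
  rw [hw, hy]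
  nlinarith

/-- The geometric-arithmetic mean inequality for traces, summed over all exponents. -/
theorem two_mul_sum_trace_le {H W Y : Matrix n n ℝ} (hH : H.IsHermitian)
    (hW : W.IsHermitian) (hY : Y.IsHermitian) (m : ℕ) :
    2 * ∑ q ∈ Finset.range (2 * m + 1), (H * W ^ q * H * Y ^ (2 * m - q)).trace ≤
      (2 * m + 1) * ((H * H * W ^ (2 * m)).trace + (H * H * Y ^ (2 * m)).trace) := by
  obtain ⟨B, hB⟩ := exists_trace_mul_pow_mul_pow hH hW hY
  have hsum : ∑ q ∈ Finset.range (2 * m + 1), (H * W ^ q * H * Y ^ (2 * m - q)).trace =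
      ∑ q ∈ Finset.range (2 * m + 1), (H * W ^ (2 * m - q) * H * Y ^ q).trace := by
    rw [← Finset.sum_range_reflect]
    refine Finset.sum_congr rfl fun q hq => ?_
    have := Finset.mem_range.1 hq
    rw [show 2 * m + 1 - 1 - q = 2 * m - q by omega, show 2 * m - (2 * m - q) = q by omega]
  have h1 : (H * H * W ^ (2 * m)).trace = (H * W ^ (2 * m) * H * Y ^ 0).trace := by
    rw [pow_zero, Matrix.mul_one, trace_mul_comm (H * W ^ (2 * m)), Matrix.mul_assoc]
  have h2 : (H * H * Y ^ (2 * m)).trace = (H * W ^ 0 * H * Y ^ (2 * m)).trace := by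
    rw [pow_zero, Matrix.mul_one]
  rw [two_mul]
  -- One copy of the sum is reflected, so that the exponents q and 2m - q are paired.
  nth_rw 2 [hsum]
  rw [← Finset.sum_add_distrib, h1, h2]
  have : ∀ q ∈ Finset.range (2 * m + 1),
      (H * W ^ q * H * Y ^ (2 * m - q)).trace + (H * W ^ (2 * m - q) * H * Y ^ q).trace ≤
      (H * W ^ (2 * m) * H * Y ^ 0).trace + (H * W ^ 0 * H * Y ^ (2 * m)).trace := by
    intro q hq
    simp only [hB, ← Finset.sum_add_distrib, ← mul_add]
    refine Finset.sum_le_sum fun k _ => Finset.sum_le_sum fun j _ => ?_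
    refine mul_le_mul_of_nonneg_left ?_ (sq_nonneg _)
    have := pow_mul_pow_add_le (hW.eigenvalues j) (hY.eigenvalues k) m q
      (by have := Finset.mem_range.1 hq; omega)
    simpa using this
  refine (Finset.sum_le_sum this).trans ?_
  rw [Finset.sum_const, Finset.card_range, nsmul_eq_mul]
  push_cast
  rfl

theorem trace_sq_mul_pow_nonneg {H W : Matrix n n ℝ} (hH : H.IsHermitian)
    (hW : W.IsHermitian) (m : ℕ) : 0 ≤ (H * H * W ^ (2 * m)).trace := by
  obtain ⟨B, hB⟩ := exists_trace_mul_pow_mul_pow hH hH hW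
  have := hB 0 (2 * m)
  rw [pow_zero, Matrix.mul_one] at this
  rw [this]
  refine Finset.sum_nonneg fun k _ => Finset.sum_nonneg fun j _ => ?_
  rw [pow_mul (hW.eigenvalues k)]
  positivity

/-- Noncommutative telescoping. With X - Y = H, the trace against H is exactly the sum bounded in
`two_mul_sum_trace_le`. -/
theorem pow_succ_sub_pow_succ (X Y : Matrix n n ℝ) (m : ℕ) :
    X ^ (m + 1) - Y ^ (m + 1) =
      ∑ q ∈ Finset.range (m + 1), X ^ q * (X - Y) * Y ^ (m - q) := by
  induction m with
  | zero => simp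
  | succ m ih =>
    rw [Finset.sum_range_succ, Nat.sub_self, pow_zero, Matrix.mul_one]
    have : ∑ q ∈ Finset.range (m + 1), X ^ q * (X - Y) * Y ^ (m + 1 - q) =
        (X ^ (m + 1) - Y ^ (m + 1)) * Y := by
      rw [ih, Finset.sum_mul]
      refine Finset.sum_congr rfl fun q hq => ?_
      have := Finset.mem_range.1 hq
      rw [show m + 1 - q = m - q + 1 by omega, pow_succ, ← Matrix.mul_assoc]
    rw [this, pow_succ X (m + 1), pow_succ Y (m + 1)]
    noncomm_ring

theorem IsHermitian.trace_pow {W : Matrix n n ℝ} (hW : W.IsHermitian) (q : ℕ) :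
    (W ^ q).trace = ∑ j, hW.eigenvalues j ^ q := by
  have h1 : W ^ q = Unitary.conjStarAlgAut ℝ _ hW.eigenvectorUnitary
      (diagonal (RCLike.ofReal ∘ hW.eigenvalues) ^ q) := by
    rw [map_pow, ← hW.spectral_theorem]
  rw [h1, Unitary.conjStarAlgAut_apply, trace_mul_comm, ← Matrix.mul_assoc, diagonal_pow]
  simp [trace]

theorem IsHermitian.toEuclideanLin_eigenvectorBasis {W : Matrix n n ℝ} (hW : W.IsHermitian)
    (j : n) : toEuclideanLin W (hW.eigenvectorBasis j) =
      hW.eigenvalues j • hW.eigenvectorBasis j := by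
  have := hW.mulVec_eigenvectorBasis j
  apply (WithLp.ofLp_injective 2)
  simpa [toLpLin_apply] using this

/-- A bound on the trace of an even power bounds the operator norm. -/
theorem IsHermitian.norm_toEuclideanLin_le {W : Matrix n n ℝ} (hW : W.IsHermitian) {m : ℕ}
    (hm : m ≠ 0) {t : ℝ} (ht : 0 ≤ t) (h : (W ^ (2 * m)).trace ≤ t ^ (2 * m))
    (x : EuclideanSpace ℝ n) : ‖toEuclideanLin W x‖ ≤ t * ‖x‖ := by
  have hev : ∀ j, hW.eigenvalues j ^ 2 ≤ t ^ 2 := by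
    intro j
    have h1 : hW.eigenvalues j ^ (2 * m) ≤ t ^ (2 * m) := by
      refine le_trans ?_ h
      rw [hW.trace_pow]
      exact Finset.single_le_sum (f := fun j => hW.eigenvalues j ^ (2 * m))
        (fun i _ => by simp only [pow_mul]; positivity) (Finset.mem_univ j)
    rw [pow_mul, pow_mul] at h1
    exact le_of_pow_le_pow_left₀ hm (by positivity) h1
  have hsymm := isSymmetric_toEuclideanLin_iff.mpr hW
  have h2 : ‖toEuclideanLin W x‖ ^ 2 ≤ (t * ‖x‖) ^ 2 := by
    rw [← hW.eigenvectorBasis.sum_sq_norm_inner_right, mul_pow,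
      ← hW.eigenvectorBasis.sum_sq_norm_inner_right x, Finset.mul_sum]
    refine Finset.sum_le_sum fun j _ => ?_
    rw [← hsymm, hW.toEuclideanLin_eigenvectorBasis, real_inner_smul_left, norm_mul, mul_pow,
      Real.norm_eq_abs, sq_abs]
    exact mul_le_mul_of_nonneg_right (hev j) (sq_nonneg _)
  exact le_of_sq_le_sq h2 (by positivity)

end Matrix

/-! ### Minimax bounds for ordered eigenvalues -/

theorem exists_ordered_eigenbasis {N : ℕ} {M : Matrix (Fin N) (Fin N) ℝ} (hM : M.IsHermitian) :
    ∃ u : OrthonormalBasis (Fin N) ℝ (EuclideanSpace ℝ (Fin N)),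
      ∀ j, Matrix.toEuclideanLin M (u j) = orderedEigenvalue hM j • u j := by
  have hs := Matrix.isSymmetric_toEuclideanLin_iff.mpr hM
  refine ⟨(hs.eigenvectorBasis finrank_euclideanSpace).reindex
    (finCongr (Fintype.card_fin N)), fun j => ?_⟩
  rw [OrthonormalBasis.reindex_apply]
  exact hs.apply_eigenvectorBasis finrank_euclideanSpace _

theorem orderedEigenvalue_antitone {N : ℕ} {M : Matrix (Fin N) (Fin N) ℝ} (hM : M.IsHermitian) :
    Antitone (orderedEigenvalue hM) := fun _ _ hab => hM.eigenvalues₀_antitone (by simpa using hab)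

theorem inner_toEuclideanLin_eq_sum {N : ℕ} {M : Matrix (Fin N) (Fin N) ℝ} (hM : M.IsHermitian)
    {u : OrthonormalBasis (Fin N) ℝ (EuclideanSpace ℝ (Fin N))}
    (hu : ∀ j, Matrix.toEuclideanLin M (u j) = orderedEigenvalue hM j • u j)
    (x : EuclideanSpace ℝ (Fin N)) :
    inner ℝ x (Matrix.toEuclideanLin M x) = ∑ j, orderedEigenvalue hM j * inner ℝ (u j) x ^ 2 := by
  have hs := Matrix.isSymmetric_toEuclideanLin_iff.mpr hM
  rw [← u.sum_inner_mul_inner]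
  refine Finset.sum_congr rfl fun j _ => ?_
  rw [← hs, hu, real_inner_smul_left, real_inner_comm]
  ring

/-- A lower bound for an ordered eigenvalue, from a family of `i + 1` test vectors. -/
theorem le_orderedEigenvalue {N : ℕ} {M : Matrix (Fin N) (Fin N) ℝ} (hM : M.IsHermitian)
    (i : Fin N) {ι : Type*} [Fintype ι] (hι : (i : ℕ) < Fintype.card ι)
    (e : ι → EuclideanSpace ℝ (Fin N)) {c : ℝ}
    (h : ∀ a : ι → ℝ, a ≠ 0 → ∑ l, a l • e l ≠ 0 ∧ c * ‖∑ l, a l • e l‖ ^ 2 ≤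
      inner ℝ (∑ l, a l • e l) (Matrix.toEuclideanLin M (∑ l, a l • e l))) :
    c ≤ orderedEigenvalue hM i := by
  obtain ⟨u, hu⟩ := exists_ordered_eigenbasis hM
  let φ : (ι → ℝ) →ₗ[ℝ] ({j : Fin N // j < i} → ℝ) :=
    LinearMap.pi fun j => (innerₛₗ ℝ (u j)).comp (Fintype.linearCombination ℝ e)
  have hcard : Fintype.card {j : Fin N // j < i} = i := by
    rw [Fintype.card_subtype]; simp [Finset.filter_gt_eq_Iio]
  -- There are more test vectors than the i eigenvectors preceding index i, so some nontrivial
  -- combination is orthogonal to all of those. On it the quadratic form is at most λ_i‖x‖².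
  have hker : LinearMap.ker φ ≠ ⊥ := by
    apply LinearMap.ker_ne_bot_of_finrank_lt
    rw [Module.finrank_fintype_fun_eq_card, Module.finrank_fintype_fun_eq_card, hcard]
    exact hι
  obtain ⟨a, ha, ha0⟩ := Submodule.exists_mem_ne_zero_of_ne_bot hker
  obtain ⟨hx0, hx⟩ := h a ha0
  set x := ∑ l, a l • e l with hxdef
  have horth : ∀ j : Fin N, j < i → inner ℝ (u j) x = 0 := by
    intro j hj
    have := congrFun (LinearMap.mem_ker.1 ha) ⟨j, hj⟩
    simpa [φ, Fintype.linearCombination_apply] using this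
  have hle : inner ℝ x (Matrix.toEuclideanLin M x) ≤ orderedEigenvalue hM i * ‖x‖ ^ 2 := by
    rw [inner_toEuclideanLin_eq_sum hM hu, ← u.sum_sq_inner_right x, Finset.mul_sum]
    refine Finset.sum_le_sum fun j _ => ?_
    rcases lt_or_ge j i with hj | hj
    · simp [horth j hj]
    · exact mul_le_mul_of_nonneg_right (orderedEigenvalue_antitone hM hj) (sq_nonneg _)
  exact le_of_mul_le_mul_right (hx.trans hle) (pow_pos (norm_pos_iff.2 hx0) 2)

/-- An upper bound for an ordered eigenvalue, from the orthogonal complement of `i` vectors. -/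
theorem orderedEigenvalue_le {N : ℕ} {M : Matrix (Fin N) (Fin N) ℝ} (hM : M.IsHermitian)
    (i : Fin N) {ι : Type*} [Fintype ι] (hι : Fintype.card ι ≤ (i : ℕ))
    (e : ι → EuclideanSpace ℝ (Fin N)) {c : ℝ}
    (h : ∀ x, (∀ l, inner ℝ (e l) x = 0) → inner ℝ x (Matrix.toEuclideanLin M x) ≤ c * ‖x‖ ^ 2) :
    orderedEigenvalue hM i ≤ c := by
  obtain ⟨u, hu⟩ := exists_ordered_eigenbasis hM
  let φ : EuclideanSpace ℝ (Fin N) →ₗ[ℝ] (ι ⊕ {j : Fin N // i < j} → ℝ) :=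
    LinearMap.pi fun s => innerₛₗ ℝ (Sum.elim e (fun j : {j : Fin N // i < j} => u j) s)
  have hcard : Fintype.card {j : Fin N // i < j} = N - 1 - i := by
    rw [Fintype.card_subtype]; simp [Finset.filter_lt_eq_Ioi]
  -- At most i + (N - 1 - i) < N conditions: some nonzero x is orthogonal to every `e l` and to
  -- every eigenvector after index i.
  have hker : LinearMap.ker φ ≠ ⊥ := by
    apply LinearMap.ker_ne_bot_of_finrank_lt
    rw [Module.finrank_fintype_fun_eq_card, Fintype.card_sum, hcard, finrank_euclideanSpace_fin]
    have := i.2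
    omega
  obtain ⟨x, hxk, hx0⟩ := Submodule.exists_mem_ne_zero_of_ne_bot hker
  have hφ : ∀ s, inner ℝ (Sum.elim e (fun j : {j : Fin N // i < j} => u j) s) x = 0 := by
    intro s
    have := congrFun (LinearMap.mem_ker.1 hxk) s
    simpa [φ] using this
  have hle : orderedEigenvalue hM i * ‖x‖ ^ 2 ≤ inner ℝ x (Matrix.toEuclideanLin M x) := by
    rw [inner_toEuclideanLin_eq_sum hM hu, ← u.sum_sq_inner_right x, Finset.mul_sum]
    refine Finset.sum_le_sum fun j _ => ?_
    rcases lt_or_ge i j with hj | hj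
    · have := hφ (Sum.inr ⟨j, hj⟩)
      simp only [Sum.elim_inr] at this
      simp [this]
    · exact mul_le_mul_of_nonneg_right (orderedEigenvalue_antitone hM hj) (sq_nonneg _)
  exact le_of_mul_le_mul_right (hle.trans (h x fun l => hφ (Sum.inl l)))
    (pow_pos (norm_pos_iff.2 hx0) 2)

/-! ### Nearly orthonormal families -/

section NearlyOrthonormal

variable {V : Type*} [NormedAddCommGroup V] [InnerProductSpace ℝ V] {ι : Type*} [Fintype ι]
  [DecidableEq ι] {e : ι → V} {η : ℝ}

/-- For a nearly orthonormal family, `‖∑ a_l e_l‖²` is close to `∑ a_l²`. -/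
theorem abs_norm_sq_sum_smul_sub_le
    (he : ∀ j l, |inner ℝ (e j) (e l) - (if j = l then 1 else 0)| ≤ η) (a : ι → ℝ) :
    |‖∑ l, a l • e l‖ ^ 2 - ∑ l, a l ^ 2| ≤ Fintype.card ι * η * ∑ l, a l ^ 2 := by
  have h1 : ‖∑ l, a l • e l‖ ^ 2 = ∑ j, ∑ l, a j * a l * inner ℝ (e j) (e l) := by
    rw [← real_inner_self_eq_norm_sq, sum_inner]
    refine Finset.sum_congr rfl fun j _ => ?_
    rw [inner_sum]
    refine Finset.sum_congr rfl fun l _ => ?_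
    rw [real_inner_smul_left, real_inner_smul_right]
    ring
  have h2 : ∑ l, a l ^ 2 = ∑ j, ∑ l, a j * a l * (if j = l then 1 else 0) := by
    refine Finset.sum_congr rfl fun j _ => ?_
    simp [sq]
  have h3 : (∑ l, |a l|) ^ 2 ≤ Fintype.card ι * ∑ l, a l ^ 2 := by
    have := sq_sum_le_card_mul_sum_sq (s := Finset.univ) (f := fun l => |a l|)
    simpa using this
  rcases isEmpty_or_nonempty ι with h | ⟨⟨i₀⟩⟩
  · simp
  have hη : 0 ≤ η := (abs_nonneg _).trans (he i₀ i₀)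
  calc |‖∑ l, a l • e l‖ ^ 2 - ∑ l, a l ^ 2|
      = |∑ j, ∑ l, a j * a l * (inner ℝ (e j) (e l) - (if j = l then 1 else 0))| := by
        rw [h1, h2, ← Finset.sum_sub_distrib]
        congr 1
        refine Finset.sum_congr rfl fun j _ => ?_
        rw [← Finset.sum_sub_distrib]
        exact Finset.sum_congr rfl fun l _ => by ring
    _ ≤ ∑ j, ∑ l, |a j| * |a l| * η := by
        refine (Finset.abs_sum_le_sum_abs _ _).trans (Finset.sum_le_sum fun j _ => ?_)
        refine (Finset.abs_sum_le_sum_abs _ _).trans (Finset.sum_le_sum fun l _ => ?_)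
        rw [abs_mul, abs_mul]
        exact mul_le_mul_of_nonneg_left (he j l) (by positivity)
    _ = η * (∑ l, |a l|) ^ 2 := by
        rw [sq, Finset.sum_mul_sum, Finset.mul_sum]
        refine Finset.sum_congr rfl fun j _ => ?_
        rw [Finset.mul_sum]
        exact Finset.sum_congr rfl fun l _ => by ring
    _ ≤ η * (Fintype.card ι * ∑ l, a l ^ 2) := mul_le_mul_of_nonneg_left h3 hη
    _ = _ := by ring

/-- Bessel's inequality for a nearly orthonormal family. -/
theorem sum_inner_sq_le_of_nearly_orthonormal
    (he : ∀ j l, |inner ℝ (e j) (e l) - (if j = l then 1 else 0)| ≤ η) (x : V) :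
    ∑ l, inner ℝ (e l) x ^ 2 ≤ (1 + Fintype.card ι * η) * ‖x‖ ^ 2 := by
  set S := ∑ l, inner ℝ (e l) x ^ 2 with hS
  have hS0 : 0 ≤ S := Finset.sum_nonneg fun l _ => sq_nonneg _
  have h1 := (abs_le.1 (abs_norm_sq_sum_smul_sub_le he fun l => inner ℝ (e l) x)).2
  -- Duality: S is the inner product of x with ∑ ⟨e_l, x⟩ e_l, whose squared norm is at most (1 +
  -- nη) S, where n is the size of the family. Cauchy–Schwarz then leaves one factor S to cancel.
  have h2 : S = inner ℝ (∑ l, (inner ℝ (e l) x : ℝ) • e l) x := by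
    rw [sum_inner]
    exact Finset.sum_congr rfl fun l _ => by rw [real_inner_smul_left, sq]
  have h3 : S ^ 2 ≤ ‖∑ l, (inner ℝ (e l) x : ℝ) • e l‖ ^ 2 * ‖x‖ ^ 2 := by
    rw [← mul_pow]
    exact pow_le_pow_left₀ hS0 (h2.le.trans (real_inner_le_norm _ _)) 2
  have h4 : S ^ 2 ≤ ((1 + Fintype.card ι * η) * S) * ‖x‖ ^ 2 :=
    h3.trans (mul_le_mul_of_nonneg_right (by linarith) (sq_nonneg _))
  rcases hS0.eq_or_lt with h | h
  · rcases isEmpty_or_nonempty ι with h' | ⟨⟨i₀⟩⟩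
    · rw [← h]; simp
    · have hη : 0 ≤ η := (abs_nonneg _).trans (he i₀ i₀)
      rw [← h]; positivity
  · nlinarith

/-- The reverse Bessel inequality on the span of a nearly orthonormal family. -/
theorem norm_sq_le_sum_inner_sq_of_nearly_orthonormal
    (he : ∀ j l, |inner ℝ (e j) (e l) - (if j = l then 1 else 0)| ≤ η)
    (hη : Fintype.card ι * η < 1) (a : ι → ℝ) :
    (1 - Fintype.card ι * η) * ‖∑ l, a l • e l‖ ^ 2 ≤
      ∑ m, inner ℝ (e m) (∑ l, a l • e l) ^ 2 := by
  set x := ∑ l, a l • e l with hx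
  set S := ∑ l, inner ℝ (e l) x ^ 2 with hS
  have hS0 : 0 ≤ S := Finset.sum_nonneg fun l _ => sq_nonneg _
  have h1 := (abs_le.1 (abs_norm_sq_sum_smul_sub_le he a)).1
  rw [← hx] at h1
  have h2 : ‖x‖ ^ 2 = ∑ l, a l * inner ℝ (e l) x := by
    rw [← real_inner_self_eq_norm_sq]
    nth_rw 1 [hx]
    rw [sum_inner]
    exact Finset.sum_congr rfl fun l _ => real_inner_smul_left _ _ _
  have h3 : (‖x‖ ^ 2) ^ 2 ≤ (∑ l, a l ^ 2) * S := by
    rw [h2]; exact Finset.sum_mul_sq_le_sq_mul_sq _ _ _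
  rcases (sq_nonneg ‖x‖).eq_or_lt with h | h
  · rw [← h]; simpa using hS0
  · have h5 : (1 - Fintype.card ι * η) * (‖x‖ ^ 2) ^ 2 ≤ ‖x‖ ^ 2 * S :=
      (mul_le_mul_of_nonneg_left h3 (by linarith)).trans
        (by rw [← mul_assoc]; exact mul_le_mul_of_nonneg_right (by linarith) hS0)
    nlinarith

end NearlyOrthonormal

/-! ### Deterministic perturbation of a finite-rank matrix -/

section Perturbation

variable {N k : ℕ} {M : Matrix (Fin N) (Fin N) ℝ} {θ : Fin k → ℝ} {T η δ : ℝ}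
  {e : Fin k → EuclideanSpace ℝ (Fin N)}
  {W : EuclideanSpace ℝ (Fin N) →ₗ[ℝ] EuclideanSpace ℝ (Fin N)}

theorem inner_lowRank_add (hMW : ∀ x, Matrix.toEuclideanLin M x =
      T • ∑ l, (θ l * inner ℝ (e l) x) • e l + W x) (x : EuclideanSpace ℝ (Fin N)) :
    inner ℝ x (Matrix.toEuclideanLin M x) =
      T * ∑ l, θ l * inner ℝ (e l) x ^ 2 + inner ℝ x (W x) := by
  rw [hMW, inner_add_right, real_inner_smul_right, inner_sum]
  congr 2
  refine Finset.sum_congr rfl fun l _ => ?_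
  rw [real_inner_smul_right, real_inner_comm]
  ring

/-- Location of the `i`-th eigenvalue of a perturbation of the matrix `T ∑ θ_l e_l e_lᵀ`. -/
theorem abs_orderedEigenvalue_sub_le (hM : M.IsHermitian) (hMW : ∀ x, Matrix.toEuclideanLin M x =
      T • ∑ l, (θ l * inner ℝ (e l) x) • e l + W x)
    (hT : 0 ≤ T) (hθ : Antitone θ) (hθ0 : ∀ l, 0 < θ l)
    (he : ∀ j l, |inner ℝ (e j) (e l) - (if j = l then 1 else 0)| ≤ η)
    (hη : k * η < 1) (hW : ∀ x, ‖W x‖ ≤ δ * T * ‖x‖) (i : Fin k) (h : (i : ℕ) < N) :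
    |orderedEigenvalue hM ⟨i, h⟩ - T * θ i| ≤ T * (θ i * (k * η) + δ) := by
  have hWx : ∀ x, |inner ℝ x (W x)| ≤ δ * T * ‖x‖ ^ 2 := fun x =>
    (abs_real_inner_le_norm _ _).trans (by
      calc ‖x‖ * ‖W x‖ ≤ ‖x‖ * (δ * T * ‖x‖) :=
            mul_le_mul_of_nonneg_left (hW x) (norm_nonneg _)
        _ = _ := by ring)
  have hη0 : 0 ≤ η := (abs_nonneg _).trans (he i i)
  have hcle : Fintype.card {l : Fin k // l ≤ i} = i + 1 := by
    rw [Fintype.card_subtype]; simp [Finset.filter_ge_eq_Iic]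
  have hcle' : (((i : ℕ) + 1 : ℕ) : ℝ) ≤ k := by exact_mod_cast i.2
  have hclt : Fintype.card {l : Fin k // l < i} = i := by
    rw [Fintype.card_subtype]; simp [Finset.filter_gt_eq_Iio]
  rw [abs_le]
  constructor
  · suffices T * (θ i * (1 - k * η) - δ) ≤ orderedEigenvalue hM ⟨i, h⟩ by linarith
    -- Test vectors: the span of the `e l` with l ≤ i, where the signal form is at least Tθ_i(1 -
    -- kη)‖x‖².
    refine le_orderedEigenvalue hM ⟨i, h⟩ (ι := {l : Fin k // l ≤ i}) (by rw [hcle]; simp)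
      (fun l => e l) fun a ha => ?_
    have he' : ∀ j l : {l : Fin k // l ≤ i},
        |inner ℝ (e j) (e l) - (if j = l then 1 else 0)| ≤ η := fun j l => by
      simpa [Subtype.ext_iff] using he j l
    have hlt : Fintype.card {l : Fin k // l ≤ i} * η ≤ k * η := by
      rw [hcle]; exact mul_le_mul_of_nonneg_right hcle' hη0
    have h1 := (abs_le.1 (abs_norm_sq_sum_smul_sub_le he' a)).1
    have h2 := norm_sq_le_sum_inner_sq_of_nearly_orthonormal he' (hlt.trans_lt hη) a
    set x := ∑ l : {l : Fin k // l ≤ i}, a l • e l with hx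
    have ha2 : 0 < ∑ l, a l ^ 2 := by
      obtain ⟨l, hl⟩ := Function.ne_iff.1 ha
      exact (pow_pos (abs_pos.2 hl) 2).trans_le (by
        rw [sq_abs]
        exact Finset.single_le_sum (f := fun l => a l ^ 2) (fun _ _ => sq_nonneg _)
          (Finset.mem_univ l))
    refine ⟨fun hx0 => ?_, ?_⟩
    · rw [hx0] at h1
      simp only [norm_zero] at h1
      nlinarith
    rw [inner_lowRank_add hMW]
    have h3 : θ i * ∑ m : {l : Fin k // l ≤ i}, inner ℝ (e m) x ^ 2 ≤
        ∑ l, θ l * inner ℝ (e l) x ^ 2 := by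
      rw [Finset.mul_sum]
      calc ∑ m : {l : Fin k // l ≤ i}, θ i * inner ℝ (e m) x ^ 2
          ≤ ∑ m : {l : Fin k // l ≤ i}, θ m * inner ℝ (e m) x ^ 2 :=
            Finset.sum_le_sum fun m _ => mul_le_mul_of_nonneg_right (hθ m.2) (sq_nonneg _)
        _ = ∑ l ∈ Finset.univ.filter (· ≤ i), θ l * inner ℝ (e l) x ^ 2 :=
            (Finset.sum_subtype _ (fun l => by simp)
              fun l => θ l * inner ℝ (e l) x ^ 2).symm
        _ ≤ _ := Finset.sum_le_sum_of_subset_of_nonneg (Finset.filter_subset _ _)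
            fun l _ _ => mul_nonneg (hθ0 l).le (sq_nonneg _)
    have h4 := (abs_le.1 (hWx x)).1
    have h5 : θ i * ((1 - k * η) * ‖x‖ ^ 2) ≤ ∑ l, θ l * inner ℝ (e l) x ^ 2 := by
      refine le_trans (mul_le_mul_of_nonneg_left (le_trans ?_ h2) (hθ0 i).le) h3
      exact mul_le_mul_of_nonneg_right (by linarith) (sq_nonneg _)
    nlinarith [mul_le_mul_of_nonneg_left h5 hT]
  · suffices orderedEigenvalue hM ⟨i, h⟩ ≤ T * (θ i * (1 + k * η) + δ) by linarith
    -- On the orthogonal complement of the `e l` with l < i, only weights θ_l ≤ θ_i survive.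
    refine orderedEigenvalue_le hM ⟨i, h⟩ (ι := {l : Fin k // l < i}) hclt.le
      (fun l => e l) fun x hx => ?_
    rw [inner_lowRank_add hMW]
    have h1 := sum_inner_sq_le_of_nearly_orthonormal he x
    rw [Fintype.card_fin] at h1
    have h3 : ∑ l, θ l * inner ℝ (e l) x ^ 2 ≤ θ i * ∑ l, inner ℝ (e l) x ^ 2 := by
      rw [Finset.mul_sum]
      refine Finset.sum_le_sum fun l _ => ?_
      rcases lt_or_ge l i with hl | hl
      · simp [hx ⟨l, hl⟩]
      · exact mul_le_mul_of_nonneg_right (hθ hl) (sq_nonneg _)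
    have h4 := (abs_le.1 (hWx x)).2
    have h5 := h3.trans (mul_le_mul_of_nonneg_left h1 (hθ0 i).le)
    nlinarith [mul_le_mul_of_nonneg_left h5 hT]

/-- Overlaps of a unit eigenvector with the vectors `e_j`. -/
theorem exists_overlap_bound (k : ℕ) {Θ κ g L c₀ : ℝ} (hΘ : 0 ≤ Θ) (hκ : 0 < κ) (hg : 0 < g)
    (hL : 0 ≤ L) (hc₀ : 0 ≤ c₀) :
    ∃ C : ℝ, 0 < C ∧ ∀ {N : ℕ} {θ : Fin k → ℝ} {T η δ lam : ℝ}
      {e : Fin k → EuclideanSpace ℝ (Fin N)}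
      {W : EuclideanSpace ℝ (Fin N) →ₗ[ℝ] EuclideanSpace ℝ (Fin N)}
      {v : EuclideanSpace ℝ (Fin N)} {i : Fin k},
      (∀ x y, inner ℝ (W x) y = inner ℝ x (W y)) → ‖v‖ = 1 →
      lam • v = T • ∑ l, (θ l * inner ℝ (e l) v) • e l + W v →
      1 ≤ T → (∀ l, 0 ≤ θ l ∧ θ l ≤ Θ) → T * η ≤ c₀ → η ≤ 1 →
      (∀ j l, |inner ℝ (e j) (e l) - (if j = l then 1 else 0)| ≤ η) →
      (∀ x, ‖W x‖ ≤ δ * T * ‖x‖) → δ ≤ κ / 2 → κ * T ≤ lam →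
      (∀ j, ‖W (e j)‖ ≤ L * √T) → (∀ j l, |inner ℝ (e j) (W (e l))| ≤ L) →
      (∀ j, j ≠ i → g * T ≤ |lam - T * θ j|) →
      (∀ j, j ≠ i → |inner ℝ (e j) v| ≤ C / T) ∧ |inner ℝ (e i) v ^ 2 - 1| ≤ C / T := by
  -- `B`√T bounds ‖Wv‖, `D` bounds ⟨W e_j, v⟩, `D'` bounds (λ - Tθ_j)c_j, `D₂` bounds ⟨v, Wv⟩ and
  -- `D₃` bounds λ - Tθ_i c_i². They depend only on the data fixed before `C`, so `C` is uniform in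
  -- N.
  set B : ℝ := 4 * k * Θ * L / κ with hB
  set D : ℝ := (2 * k * Θ * L + L * B) / κ with hD
  set D' : ℝ := 2 * k * Θ * c₀ + D with hD'
  set D₂ : ℝ := (2 * k * Θ * D + B ^ 2) / κ with hD₂
  set D₃ : ℝ := k * Θ * (D' / g) ^ 2 + D₂ with hD₃
  have hB0 : 0 ≤ B := by positivity
  have hD0 : 0 ≤ D := by positivity
  have hD'0 : 0 ≤ D' := by positivity
  have hD₂0 : 0 ≤ D₂ := by positivity
  have hD₃0 : 0 ≤ D₃ := by positivity
  refine ⟨D' / g + (D₃ + 2 * D') / κ + 1, by positivity, ?_⟩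
  intro N θ T η δ lam e W v i hsymm hv heig hT hθ hTη hη he hW hδ hlam hWe heWe hgap
  have hT0 : 0 < T := by linarith
  have hη0 : 0 ≤ η := (abs_nonneg _).trans (he i i)
  have hlam0 : 0 < lam := (mul_pos hκ hT0).trans_le hlam
  set c : Fin k → ℝ := fun l => inner ℝ (e l) v with hc
  have hen : ∀ l, ‖e l‖ ≤ 2 := by
    intro l
    have := (abs_le.1 (he l l)).2
    rw [if_pos rfl, real_inner_self_eq_norm_sq] at this
    nlinarith [norm_nonneg (e l)]
  have hcl : ∀ l, |c l| ≤ 2 := fun l => by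
    have := abs_real_inner_le_norm (e l) v
    rw [hv, mul_one] at this
    exact this.trans (hen l)
  -- sums weighted by `θ_l c_l`
  have hsum : ∀ (y : Fin k → ℝ) (Y : ℝ), (∀ l, |y l| ≤ Y) →
      |∑ l, θ l * c l * y l| ≤ 2 * k * Θ * Y := by
    intro y Y hy
    calc |∑ l, θ l * c l * y l| ≤ ∑ l : Fin k, Θ * 2 * Y := by
          refine (Finset.abs_sum_le_sum_abs _ _).trans (Finset.sum_le_sum fun l _ => ?_)
          rw [abs_mul, abs_mul, abs_of_nonneg (hθ l).1]
          exact mul_le_mul (mul_le_mul (hθ l).2 (hcl l) (abs_nonneg _) hΘ) (hy l) (abs_nonneg _)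
            (by positivity)
      _ = 2 * k * Θ * Y := by
          rw [Finset.sum_const, Finset.card_univ, Fintype.card_fin, nsmul_eq_mul]; ring
  have hexp : ∀ z, lam * inner ℝ z v = T * ∑ l, θ l * c l * inner ℝ z (e l) + inner ℝ z (W v) := by
    intro z
    rw [← real_inner_smul_right, heig, inner_add_right, real_inner_smul_right, inner_sum]
    congr 2
    exact Finset.sum_congr rfl fun l _ => real_inner_smul_right _ _ _
  have hdiv : ∀ {y Y : ℝ}, lam * |y| ≤ T * Y → |y| ≤ Y / κ := by
    intro y Y h
    rw [le_div_iff₀ hκ]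
    have := (mul_le_mul_of_nonneg_right hlam (abs_nonneg y)).trans h
    nlinarith
  have hsq : √T * √T = T := Real.mul_self_sqrt hT0.le
  have hsT : 0 < √T := Real.sqrt_pos.2 hT0
  -- the noise applied to the eigenvector
  have hWv : ‖W v‖ ≤ B * √T := by
    -- `W` is applied to the eigenvalue equation. The term W(Wv) has norm at most κT/2 · ‖Wv‖, half
    -- of the lower bound for the left side, and is absorbed.
    have h1 : lam • W v = T • ∑ l, (θ l * c l) • W (e l) + W (W v) := by
      rw [← map_smul, heig, map_add, map_smul, map_sum]
      congr 2
      exact Finset.sum_congr rfl fun l _ => map_smul _ _ _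
    have h2 : lam * ‖W v‖ ≤ T * (2 * k * Θ * (L * √T)) + δ * T * ‖W v‖ := by
      rw [← abs_of_pos hlam0, ← Real.norm_eq_abs, ← norm_smul, h1]
      refine (norm_add_le _ _).trans (add_le_add ?_ (hW _))
      rw [norm_smul, Real.norm_eq_abs, abs_of_pos hT0]
      refine mul_le_mul_of_nonneg_left ?_ hT0.le
      calc ‖∑ l, (θ l * c l) • W (e l)‖ ≤ ∑ l : Fin k, Θ * 2 * (L * √T) := by
            refine (norm_sum_le _ _).trans (Finset.sum_le_sum fun l _ => ?_)
            rw [norm_smul, Real.norm_eq_abs, abs_mul, abs_of_nonneg (hθ l).1]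
            exact mul_le_mul (mul_le_mul (hθ l).2 (hcl l) (abs_nonneg _) hΘ) (hWe l)
              (norm_nonneg _) (by positivity)
        _ = _ := by
            rw [Finset.sum_const, Finset.card_univ, Fintype.card_fin, nsmul_eq_mul]; ring
    have h3 : κ / 2 * ‖W v‖ ≤ 2 * k * Θ * (L * √T) := by
      have a1 := mul_le_mul_of_nonneg_right hlam (norm_nonneg (W v))
      have a2 : δ * (T * ‖W v‖) ≤ κ / 2 * (T * ‖W v‖) :=
        mul_le_mul_of_nonneg_right hδ (by positivity)
      have : T * (κ / 2 * ‖W v‖) ≤ T * (2 * k * Θ * (L * √T)) := by linarith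
      exact le_of_mul_le_mul_left this hT0
    have : ‖W v‖ ≤ 2 * k * Θ * (L * √T) / (κ / 2) := by
      rw [le_div_iff₀ (by positivity)]; linarith
    refine this.trans (le_of_eq ?_)
    rw [hB]; field_simp; ring
  have hWev : ∀ j, |inner ℝ (W (e j)) v| ≤ D := by
    intro j
    -- The equation is paired with W e_j. The noise term is ⟨W e_j, Wv⟩, at most L√T · B√T, which is
    -- again of order T.
    refine hdiv ?_
    rw [← abs_of_pos hlam0, ← abs_mul, hexp]
    refine (abs_add_le _ _).trans ?_
    rw [abs_mul, abs_of_pos hT0, mul_add]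
    refine add_le_add (mul_le_mul_of_nonneg_left (hsum _ L fun l => ?_) hT0.le) ?_
    · rw [hsymm]; exact heWe j l
    · refine (abs_real_inner_le_norm _ _).trans ((mul_le_mul (hWe j) hWv (norm_nonneg _)
        (by positivity)).trans (le_of_eq ?_))
      rw [show L * √T * (B * √T) = √T * √T * (L * B) by ring, hsq]
  have hmain : ∀ j, |(lam - T * θ j) * c j| ≤ D' := by
    intro j
    -- Pairing with e_j and removing the diagonal of the Gram matrix leaves its defect, at most η
    -- per entry, multiplied by T. This is bounded because Tη ≤ c₀.
    have h1 : (lam - T * θ j) * c j = T * ∑ l, θ l * c l *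
        (inner ℝ (e j) (e l) - (if j = l then 1 else 0)) + inner ℝ (W (e j)) v := by
      have h2 := hexp (e j)
      rw [← hsymm] at h2
      have h3 : ∑ l, θ l * c l * (inner ℝ (e j) (e l) - (if j = l then 1 else 0)) =
          ∑ l, θ l * c l * inner ℝ (e j) (e l) - θ j * c j := by
        simp [mul_sub, Finset.sum_sub_distrib]
      rw [h3, mul_sub, sub_mul]
      change lam * c j = _ at h2
      rw [h2]; ring
    rw [h1]
    refine (abs_add_le _ _).trans (add_le_add ?_ (hWev j))
    rw [abs_mul, abs_of_pos hT0]
    calc T * _ ≤ T * (2 * k * Θ * η) := mul_le_mul_of_nonneg_left (hsum _ η (he j)) hT0.le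
      _ = 2 * k * Θ * (T * η) := by ring
      _ ≤ _ := mul_le_mul_of_nonneg_left hTη (by positivity)
  have hoff : ∀ j, j ≠ i → |c j| ≤ D' / g / T := by
    intro j hj
    have h1 := hmain j
    rw [abs_mul] at h1
    rw [div_div, le_div_iff₀ (by positivity)]
    have := (mul_le_mul_of_nonneg_right (hgap j hj) (abs_nonneg (c j))).trans h1
    linarith
  have hvWv : |inner ℝ v (W v)| ≤ D₂ := by
    -- The equation is paired with Wv, which produces ‖Wv‖² = O(T).
    refine hdiv ?_
    rw [← abs_of_pos hlam0, ← abs_mul, real_inner_comm, hexp]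
    refine (abs_add_le _ _).trans ?_
    rw [abs_mul, abs_of_pos hT0, mul_add]
    refine add_le_add (mul_le_mul_of_nonneg_left (hsum _ D fun l => ?_) hT0.le) ?_
    · rw [hsymm, real_inner_comm]; exact hWev l
    · rw [real_inner_self_eq_norm_sq, abs_of_nonneg (sq_nonneg _)]
      calc ‖W v‖ ^ 2 ≤ (B * √T) ^ 2 := pow_le_pow_left₀ (norm_nonneg _) hWv 2
        _ = _ := by rw [mul_pow, Real.sq_sqrt hT0.le]; ring
  have hdiag : |lam - T * θ i * c i ^ 2| ≤ D₃ := by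
    have h1 : lam - T * θ i * c i ^ 2 =
        T * ∑ l ∈ Finset.univ.erase i, θ l * c l ^ 2 + inner ℝ v (W v) := by
      have h2 := hexp v
      rw [real_inner_self_eq_norm_sq, hv, one_pow, mul_one] at h2
      have h3 : ∑ l, θ l * c l * inner ℝ v (e l) = ∑ l, θ l * c l ^ 2 :=
        Finset.sum_congr rfl fun l _ => by rw [real_inner_comm, sq, mul_assoc]
      rw [h3, ← Finset.add_sum_erase _ _ (Finset.mem_univ i)] at h2
      rw [h2]; ring
    rw [h1]
    refine (abs_add_le _ _).trans (add_le_add ?_ hvWv)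
    have h2 : ∀ l ∈ Finset.univ.erase i, θ l * c l ^ 2 ≤ Θ * (D' / g / T) ^ 2 := by
      intro l hl
      refine mul_le_mul (hθ l).2 ?_ (sq_nonneg _) hΘ
      rw [← sq_abs]
      exact pow_le_pow_left₀ (abs_nonneg _) (hoff l (Finset.ne_of_mem_erase hl)) 2
    rw [abs_of_nonneg (mul_nonneg hT0.le
      (Finset.sum_nonneg fun l _ => mul_nonneg (hθ l).1 (sq_nonneg _)))]
    have h3 : ((Finset.univ.erase i).card : ℝ) ≤ k := by
      have := Finset.card_le_univ (Finset.univ.erase i)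
      rw [Fintype.card_fin] at this
      exact_mod_cast this
    calc T * ∑ l ∈ Finset.univ.erase i, θ l * c l ^ 2
        ≤ T * (k * (Θ * (D' / g / T) ^ 2)) := by
          refine mul_le_mul_of_nonneg_left ((Finset.sum_le_sum h2).trans ?_) hT0.le
          rw [Finset.sum_const, nsmul_eq_mul]
          exact mul_le_mul_of_nonneg_right h3 (by positivity)
      _ = k * Θ * (D' / g) ^ 2 / T := by field_simp
      _ ≤ _ := div_le_self (by positivity) hT
  refine ⟨fun j hj => (hoff j hj).trans ?_, ?_⟩
  · refine div_le_div_of_nonneg_right ?_ hT0.le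
    have : 0 ≤ (D₃ + 2 * D') / κ := by positivity
    linarith
  -- Tθ_i c_i² is eliminated between the bounds from pairing with e_i and with v, both O(1).
  · have h1 : lam * (c i ^ 2 - 1) = (lam - T * θ i) * c i * c i - (lam - T * θ i * c i ^ 2) := by
      ring
    have h2 : lam * |c i ^ 2 - 1| ≤ D₃ + 2 * D' := by
      rw [← abs_of_pos hlam0, ← abs_mul, h1]
      refine (abs_sub _ _).trans ?_
      rw [abs_mul]
      have := mul_le_mul (hmain i) (hcl i) (abs_nonneg _) hD'0
      linarith
    have h3 : |c i ^ 2 - 1| ≤ (D₃ + 2 * D') / κ / T := by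
      rw [div_div, le_div_iff₀ (by positivity)]
      have := (mul_le_mul_of_nonneg_right hlam (abs_nonneg (c i ^ 2 - 1))).trans h2
      linarith
    refine h3.trans (div_le_div_of_nonneg_right ?_ hT0.le)
    have : 0 ≤ D' / g := by positivity
    linarith

/-- An eigenvalue all of whose eigenvectors have a nonzero component along `e` is simple. -/
theorem isSimpleEigenvalue_of_inner_ne_zero {N : ℕ} {M : Matrix (Fin N) (Fin N) ℝ}
    (hM : M.IsHermitian) (i : Fin N) (e : EuclideanSpace ℝ (Fin N))
    (h : ∀ v, IsUnitEigenvector M (orderedEigenvalue hM i) v → inner ℝ e v ≠ 0) :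
    IsSimpleEigenvalue M (orderedEigenvalue hM i) := by
  set S := Module.End.eigenspace (Matrix.toEuclideanLin M) (orderedEigenvalue hM i) with hS
  change Module.finrank ℝ S = 1
  apply le_antisymm
  -- The functional ⟨e, ·⟩ has trivial kernel on the eigenspace, whose dimension is therefore at
  -- most one.
  · have hinj : Function.Injective ((innerₛₗ ℝ e).comp S.subtype) := by
      rw [← LinearMap.ker_eq_bot, LinearMap.ker_eq_bot']
      intro v hv
      by_contra hv0
      have hv0' : ‖(v : EuclideanSpace ℝ (Fin N))‖ ≠ 0 := by simpa using hv0
      have hvS := Module.End.mem_eigenspace_iff.1 v.2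
      refine h (‖(v : EuclideanSpace ℝ (Fin N))‖⁻¹ • v) ⟨?_, ?_⟩ ?_
      · rw [norm_smul, norm_inv, norm_norm, inv_mul_cancel₀ hv0']
      · rw [map_smul, hvS, smul_comm]
      · rw [real_inner_smul_right]
        have : inner ℝ e (v : EuclideanSpace ℝ (Fin N)) = 0 := by simpa using hv
        rw [this, mul_zero]
    have := LinearMap.finrank_le_finrank_of_injective hinj
    simpa using this
  · obtain ⟨u, hu⟩ := exists_ordered_eigenbasis hM
    have : Nontrivial S := by
      refine ⟨⟨⟨u i, Module.End.mem_eigenspace_iff.2 (hu i)⟩, 0, fun h0 => ?_⟩⟩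
      exact u.orthonormal.ne_zero i (by simpa using congrArg Subtype.val h0)
    exact Module.finrank_pos

end Perturbation

/-! ### Riemann sums and discretised eigenfunctions -/

/-- Error of a right-endpoint Riemann sum of a Lipschitz function. -/
theorem abs_riemann_sum_sub_integral_le {φ : ℝ → ℝ} {K : ℝ}
    (hφ : ∀ x ∈ Icc (0 : ℝ) 1, ∀ y ∈ Icc (0 : ℝ) 1, |φ x - φ y| ≤ K * |x - y|) {N : ℕ}
    (hN : 0 < N) :
    |∑ a : Fin N, (N : ℝ)⁻¹ * φ (((a : ℕ) + 1 : ℝ) / N) - ∫ x in Icc (0 : ℝ) 1, φ x| ≤ K / N := by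
  have hN' : (0 : ℝ) < N := by exact_mod_cast hN
  have hK : 0 ≤ K := by
    have := (abs_nonneg _).trans (hφ 0 (by simp) 1 (by simp))
    simpa using this
  have hcont : ContinuousOn φ (Icc 0 1) := by
    have : LipschitzOnWith K.toNNReal φ (Icc 0 1) := LipschitzOnWith.of_dist_le_mul
      fun x hx y hy => by
        rw [Real.coe_toNNReal K hK, Real.dist_eq, Real.dist_eq]; exact hφ x hx y hy
    exact this.continuousOn
  let t : ℕ → ℝ := fun a => (a : ℝ) / N
  have ht : ∀ a, a < N → t a ∈ Icc (0 : ℝ) 1 ∧ t (a + 1) ∈ Icc (0 : ℝ) 1 := by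
    intro a ha
    have h1 : ((a + 1 : ℕ) : ℝ) ≤ N := by exact_mod_cast ha
    have h2 : (a : ℝ) ≤ N := by exact_mod_cast ha.le
    exact ⟨⟨by positivity, (div_le_one hN').2 h2⟩, ⟨by positivity, (div_le_one hN').2 h1⟩⟩
  have htt : ∀ a, t a ≤ t (a + 1) := fun a =>
    div_le_div_of_nonneg_right (by push_cast; linarith) hN'.le
  have hint : ∀ a < N, IntervalIntegrable φ volume (t a) (t (a + 1)) := by
    intro a ha
    refine (hcont.mono ?_).intervalIntegrable
    rw [uIcc_of_le (htt a)]
    exact Icc_subset_Icc (ht a ha).1.1 (ht a ha).2.2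
  have hsplit : ∫ x in Icc (0 : ℝ) 1, φ x =
      ∑ a ∈ Finset.range N, ∫ x in t a..t (a + 1), φ x := by
    rw [intervalIntegral.sum_integral_adjacent_intervals hint, integral_Icc_eq_integral_Ioc,
      ← intervalIntegral.integral_of_le zero_le_one]
    simp [t, hN'.ne']
  rw [hsplit, ← Finset.sum_range fun a => (N : ℝ)⁻¹ * φ (((a : ℕ) + 1 : ℝ) / N),
    ← Finset.sum_sub_distrib]
  calc |∑ a ∈ Finset.range N, ((N : ℝ)⁻¹ * φ (((a : ℕ) + 1 : ℝ) / N) - ∫ x in t a..t (a + 1), φ x)|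
      ≤ ∑ a ∈ Finset.range N, K * (N : ℝ)⁻¹ * (N : ℝ)⁻¹ := by
        refine (Finset.abs_sum_le_sum_abs _ _).trans (Finset.sum_le_sum fun a ha => ?_)
        have ha' := Finset.mem_range.1 ha
        have hlen : t (a + 1) - t a = (N : ℝ)⁻¹ := by simp only [t]; push_cast; field_simp; ring
        -- On a cell of length 1/N the integrand differs from its right-endpoint value by at most
        -- K/N, so each cell contributes at most K/N².
        have h1 : (N : ℝ)⁻¹ * φ (((a : ℕ) + 1 : ℝ) / N) - ∫ x in t a..t (a + 1), φ x =
            ∫ x in t a..t (a + 1), (φ (t (a + 1)) - φ x) := by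
          rw [intervalIntegral.integral_sub (by simp) (hint a ha'),
            intervalIntegral.integral_const, hlen, smul_eq_mul]
          simp [t]
        rw [h1, ← Real.norm_eq_abs]
        have h2 := intervalIntegral.norm_integral_le_of_norm_le_const (a := t a) (b := t (a + 1))
          (f := fun x => φ (t (a + 1)) - φ x) (C := K * (N : ℝ)⁻¹) (fun x hx => by
            rw [uIoc_of_le (htt a)] at hx
            have hx' : x ∈ Icc (0 : ℝ) 1 :=
              ⟨(ht a ha').1.1.trans hx.1.le, hx.2.trans (ht a ha').2.2⟩
            refine (hφ _ (ht a ha').2 x hx').trans (mul_le_mul_of_nonneg_left ?_ hK)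
            rw [abs_of_nonneg (by linarith [hx.2]), ← hlen]
            linarith [hx.1])
        rwa [hlen, abs_of_pos (inv_pos.2 hN')] at h2
    _ = K / N := by
        rw [Finset.sum_const, Finset.card_range, nsmul_eq_mul]; field_simp

theorem inner_discretize (g h : ℝ → ℝ) (N : ℕ) :
    inner ℝ (discretize g N) (discretize h N) =
      ∑ a : Fin N, (N : ℝ)⁻¹ * (g (((a : ℕ) + 1 : ℝ) / N) * h (((a : ℕ) + 1 : ℝ) / N)) := by
  simp only [discretize, PiLp.inner_apply, RCLike.inner_apply, conj_trivial]
  refine Finset.sum_congr rfl fun a _ => ?_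
  have : (√(N : ℝ))⁻¹ * (√(N : ℝ))⁻¹ = (N : ℝ)⁻¹ := by
    rw [← mul_inv, Real.mul_self_sqrt (Nat.cast_nonneg N)]
  rw [← this]; ring

theorem AssumptionF2.exists_bound {k : ℕ} {r : Fin k → ℝ → ℝ} (hr : AssumptionF2 r) :
    ∃ R : ℝ, 0 ≤ R ∧ ∀ i, ∀ x ∈ Icc (0 : ℝ) 1, |r i x| ≤ R ∧
      ∀ y ∈ Icc (0 : ℝ) 1, |r i x - r i y| ≤ R * |x - y| := by
  choose K hK using hr
  refine ⟨∑ i, (|r i 0| + |K i|), by positivity, fun i x hx => ?_⟩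
  have hi : |r i 0| + |K i| ≤ ∑ i, (|r i 0| + |K i|) :=
    Finset.single_le_sum (f := fun i => |r i 0| + |K i|) (fun _ _ => by positivity)
      (Finset.mem_univ i)
  constructor
  · refine le_trans ?_ hi
    have h1 := hK i x hx 0 (by simp)
    have h2 : K i * |x - 0| ≤ |K i| := by
      rw [sub_zero, abs_of_nonneg hx.1]
      calc K i * x ≤ |K i| * x := mul_le_mul_of_nonneg_right (le_abs_self _) hx.1
        _ ≤ |K i| * 1 := mul_le_mul_of_nonneg_left hx.2 (abs_nonneg _)
        _ = _ := mul_one _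
    have h3 : |r i x| ≤ |r i x - r i 0| + |r i 0| := by
      simpa using abs_add_le (r i x - r i 0) (r i 0)
    linarith
  · intro y hy
    refine (hK i x hx y hy).trans (mul_le_mul_of_nonneg_right ?_ (abs_nonneg _))
    linarith [le_abs_self (K i), abs_nonneg (r i 0)]

theorem mem_Icc_grid {N : ℕ} (a : Fin N) : (((a : ℕ) + 1 : ℝ) / N) ∈ Icc (0 : ℝ) 1 := by
  have h : ((a : ℕ) + 1 : ℝ) ≤ N := by exact_mod_cast a.2
  have : (0 : ℝ) < N := lt_of_lt_of_le (by positivity) h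
  exact ⟨by positivity, (div_le_one this).2 h⟩

/-- The discretised eigenfunctions are nearly orthonormal. -/
theorem abs_inner_discretize_sub_le {k : ℕ} {f : ℝ → ℝ → ℝ} {θ : Fin k → ℝ} {r : Fin k → ℝ → ℝ}
    (hf : IsSpectralKernel f θ r) {R : ℝ} (hR0 : 0 ≤ R)
    (hR : ∀ i, ∀ x ∈ Icc (0 : ℝ) 1, |r i x| ≤ R ∧
      ∀ y ∈ Icc (0 : ℝ) 1, |r i x - r i y| ≤ R * |x - y|) {N : ℕ} (hN : 0 < N) (j l : Fin k) :
    |inner ℝ (discretize (r j) N) (discretize (r l) N) - (if j = l then 1 else 0)| ≤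
      2 * R ^ 2 / N := by
  rw [inner_discretize, ← hf.orthonormal j l]
  refine abs_riemann_sum_sub_integral_le (φ := fun x => r j x * r l x) (fun x hx y hy => ?_) hN
  calc |r j x * r l x - r j y * r l y|
      = |r j x * (r l x - r l y) + (r j x - r j y) * r l y| := by congr 1; ring
    _ ≤ R * (R * |x - y|) + R * |x - y| * R := by
        refine (abs_add_le _ _).trans ?_
        rw [abs_mul, abs_mul]
        exact add_le_add
          (mul_le_mul (hR j x hx).1 ((hR l x hx).2 y hy) (abs_nonneg _) hR0)
          (mul_le_mul ((hR j x hx).2 y hy) (hR l y hy).1 (abs_nonneg _) (by positivity))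
    _ = _ := by ring

/-! ### Independent Bernoulli variables on the boolean cube -/

/-- The numerical value of a boolean. -/
def boolVal (b : Bool) : ℝ := if b then 1 else 0

@[simp] theorem boolVal_true : boolVal true = 1 := rfl

@[simp] theorem boolVal_false : boolVal false = 0 := rfl

theorem boolVal_mem (b : Bool) : 0 ≤ boolVal b ∧ boolVal b ≤ 1 := by cases b <;> simp

theorem integrable_boolFun {E : Type*} [Finite E] (μ : Measure (E → Bool)) [IsFiniteMeasure μ]
    (G : (E → Bool) → ℝ) : Integrable G μ := Integrable.of_finite

section Bernoulli

variable {E : Type*} [Fintype E] [DecidableEq E]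

/-- The law of a family of independent Bernoulli variables with parameters `p e`, characterised by
its action on products with functions that do not depend on one of the coordinates. -/
def IsBernoulliLaw (μ : Measure (E → Bool)) (p : E → ℝ) : Prop :=
  ∀ (e : E) (G : (E → Bool) → ℝ), (∀ x b, G (Function.update x e b) = G x) →
    ∫ x, boolVal (x e) * G x ∂μ = p e * ∫ x, G x ∂μ

/-- The joint law of independent boolean variables. -/
theorem isBernoulliLaw_map {Ω : Type*} [MeasurableSpace Ω] {P : Measure Ω}
    [IsProbabilityMeasure P] {B : E → Ω → Bool} (hB : ∀ e, Measurable (B e))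
    (hind : iIndepFun B P) {p : E → ℝ} (hp : ∀ e, ∫ ω, boolVal (B e ω) ∂P = p e) :
    IsBernoulliLaw (P.map fun ω e => B e ω) p := by
  intro e G hG
  have hBm : Measurable fun ω e => B e ω := measurable_pi_lambda _ hB
  rw [integral_map hBm.aemeasurable (measurable_of_finite _).aestronglyMeasurable,
    integral_map hBm.aemeasurable (measurable_of_finite _).aestronglyMeasurable]
  have h1 := hind.indepFun_finset {e} (Finset.univ.erase e) (by simp) hB
  let φ : (↥({e} : Finset E) → Bool) → ℝ := fun y => boolVal (y ⟨e, by simp⟩)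
  let ψ : (↥(Finset.univ.erase e) → Bool) → ℝ := fun y =>
    G fun f => if h : f ∈ Finset.univ.erase e then y ⟨f, h⟩ else false
  have h2 := h1.comp (φ := φ) (ψ := ψ) (measurable_of_finite _) (measurable_of_finite _)
  have hψ : ∀ ω, ψ (fun i : (Finset.univ.erase e : Finset E) => B i ω) = G fun e => B e ω := by
    intro ω
    -- `ψ` fills the missing coordinate e with `false`, which `G` does not see.
    rw [← hG (fun e => B e ω) false]
    simp only [ψ]
    congr 1
    ext f
    by_cases hf : f = e
    · subst hf; simp
    · simp [hf]
  have h3 := h2.integral_fun_mul_eq_mul_integral (by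
    exact ((measurable_of_finite φ).comp (measurable_pi_lambda _ fun i => hB i)).aestronglyMeasurable)
    (by
    exact ((measurable_of_finite ψ).comp (measurable_pi_lambda _ fun i => hB i)).aestronglyMeasurable)
  simp only [Function.comp_apply, hψ] at h3
  rw [h3]
  simp only [φ, hp]

variable {μ : Measure (E → Bool)} [IsProbabilityMeasure μ] {p : E → ℝ}

omit [Fintype E] in
theorem IsBernoulliLaw.integral_boolVal (hμ : IsBernoulliLaw μ p) (e : E) :
    ∫ x, boolVal (x e) ∂μ = p e := by
  simpa using hμ e (fun _ => 1) fun _ _ => rfl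

theorem IsBernoulliLaw.mem_Icc (hμ : IsBernoulliLaw μ p) (e : E) : 0 ≤ p e ∧ p e ≤ 1 := by
  rw [← hμ.integral_boolVal e]
  refine ⟨integral_nonneg fun x => (boolVal_mem _).1, ?_⟩
  have := integral_mono (integrable_boolFun μ fun x => boolVal (x e)) (integrable_boolFun μ fun _ => 1)
    fun x => (boolVal_mem (x e)).2
  simpa using this

omit [Fintype E] [IsProbabilityMeasure μ] in
-- Where the coordinate e is `true`, `G` may be evaluated with that coordinate frozen. The frozen
-- function no longer depends on it, so the defining property of the law applies.
theorem IsBernoulliLaw.integral_true (hμ : IsBernoulliLaw μ p) (e : E) (G : (E → Bool) → ℝ) :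
    ∫ x, boolVal (x e) * G x ∂μ = p e * ∫ x, G (Function.update x e true) ∂μ := by
  rw [← hμ e (fun x => G (Function.update x e true)) fun x b => by simp]
  refine integral_congr_ae (Eventually.of_forall fun x => ?_)
  change boolVal (x e) * G x = boolVal (x e) * G (Function.update x e true)
  cases h : x e
  · simp
  · rw [← h, Function.update_eq_self]

theorem IsBernoulliLaw.integral_false (hμ : IsBernoulliLaw μ p) (e : E) (G : (E → Bool) → ℝ) :
    ∫ x, (1 - boolVal (x e)) * G x ∂μ = (1 - p e) * ∫ x, G (Function.update x e false) ∂μ := by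
  have h1 := hμ e (fun x => G (Function.update x e false)) fun x b => by simp
  rw [sub_mul, one_mul, ← h1, ← integral_sub (integrable_boolFun μ _) (integrable_boolFun μ _)]
  refine integral_congr_ae (Eventually.of_forall fun x => ?_)
  change (1 - boolVal (x e)) * G x = G (Function.update x e false) -
    boolVal (x e) * G (Function.update x e false)
  cases h : x e
  · rw [← h, Function.update_eq_self]; simp [h]
  · simp

/-- Integration by parts for a centred Bernoulli coordinate. -/
theorem IsBernoulliLaw.integral_sub_mul (hμ : IsBernoulliLaw μ p) (e : E) (G : (E → Bool) → ℝ) :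
    ∫ x, (boolVal (x e) - p e) * G x ∂μ = p e * (1 - p e) *
      ∫ x, (G (Function.update x e true) - G (Function.update x e false)) ∂μ := by
  rw [integral_sub (integrable_boolFun μ _) (integrable_boolFun μ _)]
  have h1 := hμ.integral_true e G
  have h2 := hμ.integral_false e G
  have h3 : ∫ x, (boolVal (x e) - p e) * G x ∂μ = (1 - p e) * ∫ x, boolVal (x e) * G x ∂μ -
      p e * ∫ x, (1 - boolVal (x e)) * G x ∂μ := by
    rw [← integral_const_mul, ← integral_const_mul,
      ← integral_sub (integrable_boolFun μ _) (integrable_boolFun μ _)]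
    refine integral_congr_ae (Eventually.of_forall fun x => ?_)
    ring
  rw [h3, h1, h2]; ring

/-- One coordinate at a time: each contributes the factor 1 + (e - 1)p ≤ exp(2p), as e - 1 ≤ 2. -/
theorem IsBernoulliLaw.integral_exp_sum_le (hμ : IsBernoulliLaw μ p) (S : Finset E) :
    ∫ x, Real.exp (∑ e ∈ S, boolVal (x e)) ∂μ ≤ Real.exp (2 * ∑ e ∈ S, p e) := by
  induction S using Finset.induction_on with
  | empty => simp
  | insert e S he ih =>
    set G : (E → Bool) → ℝ := fun x => Real.exp (∑ f ∈ S, boolVal (x f)) with hG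
    have h1 : ∀ x : E → Bool, Real.exp (∑ f ∈ insert e S, boolVal (x f)) =
        G x + (Real.exp 1 - 1) * (boolVal (x e) * G x) := by
      intro x
      rw [Finset.sum_insert he, Real.exp_add]
      cases x e <;> simp [hG]
      ring
    have h2 := hμ e G fun x b => by
      simp only [hG]
      congr 1
      refine Finset.sum_congr rfl fun f hf => ?_
      rw [Function.update_of_ne (by rintro rfl; exact he hf)]
    have hG0 : 0 ≤ ∫ x, G x ∂μ := integral_nonneg fun x => (Real.exp_pos _).le
    simp only [h1]
    rw [integral_add (integrable_boolFun μ _) (integrable_boolFun μ _), integral_const_mul, h2,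
      Finset.sum_insert he, mul_add, Real.exp_add]
    have hp := hμ.mem_Icc e
    have h3 : 1 + (Real.exp 1 - 1) * p e ≤ Real.exp (2 * p e) := by
      have := Real.add_one_le_exp (2 * p e)
      have := Real.exp_one_lt_d9
      nlinarith
    calc (∫ x, G x ∂μ) + (Real.exp 1 - 1) * (p e * ∫ x, G x ∂μ)
        = (1 + (Real.exp 1 - 1) * p e) * ∫ x, G x ∂μ := by ring
      _ ≤ _ := mul_le_mul h3 ih hG0 (Real.exp_pos _).le

/-- Second moment of a linear form in centred Bernoulli variables, each used at most twice. -/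
theorem IsBernoulliLaw.integral_sq_sum_le (hμ : IsBernoulliLaw μ p) {ι : Type*} [Fintype ι]
    (φ : ι → E) (hφ : ∀ i, (Finset.univ.filter fun j => φ j = φ i).card ≤ 2) {m s : ℝ}
    (c : ι → ℝ) (hc : ∀ i, |c i| ≤ m) (hp : ∀ e, p e ≤ s) :
    ∫ x, (∑ i, c i * (boolVal (x (φ i)) - p (φ i))) ^ 2 ∂μ ≤
      Fintype.card ι * (2 * (m ^ 2 * s)) := by
  -- Integration by parts: flipping the coordinate e changes x_f - p_f by 1 if f = e and by 0
  -- otherwise.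
  have hcov : ∀ e f, ∫ x, (boolVal (x e) - p e) * (boolVal (x f) - p f) ∂μ =
      if f = e then p e * (1 - p e) else 0 := by
    intro e f
    rw [hμ.integral_sub_mul e fun x => boolVal (x f) - p f]
    split_ifs with h
    · subst h; simp
    · simp [Function.update_of_ne h]
  have h1 : ∀ x : E → Bool, (∑ i, c i * (boolVal (x (φ i)) - p (φ i))) ^ 2 =
      ∑ i, ∑ j, c i * c j * ((boolVal (x (φ i)) - p (φ i)) * (boolVal (x (φ j)) - p (φ j))) := by
    intro x
    rw [sq, Finset.sum_mul_sum]
    exact Finset.sum_congr rfl fun i _ => Finset.sum_congr rfl fun j _ => by ring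
  simp only [h1]
  rw [integral_finsetSum _ fun _ _ => integrable_boolFun μ _]
  calc _ ≤ ∑ i : ι, 2 * (m ^ 2 * s) := by
        refine Finset.sum_le_sum fun i _ => ?_
        rw [integral_finsetSum _ fun _ _ => integrable_boolFun μ _]
        simp only [integral_const_mul, hcov, mul_ite, mul_zero]
        rw [← Finset.sum_filter]
        have hpi := hμ.mem_Icc (φ i)
        have hms : 0 ≤ m ^ 2 * s := mul_nonneg (sq_nonneg _) (hpi.1.trans (hp _))
        have hm : 0 ≤ m := (abs_nonneg _).trans (hc i)
        calc _ ≤ ∑ j ∈ Finset.univ.filter fun j => φ j = φ i, m ^ 2 * s := by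
              refine Finset.sum_le_sum fun j _ => ?_
              refine mul_le_mul ?_ ?_ (mul_nonneg hpi.1 (by linarith [hpi.2])) (sq_nonneg _)
              · rw [sq]
                refine (le_abs_self _).trans ?_
                rw [abs_mul]
                exact mul_le_mul (hc i) (hc j) (abs_nonneg _) hm
              · nlinarith [hp (φ i), hpi.1]
          _ ≤ _ := by
              rw [Finset.sum_const, nsmul_eq_mul]
              exact mul_le_mul_of_nonneg_right (by exact_mod_cast hφ i) hms
    _ = _ := by rw [Finset.sum_const, Finset.card_univ, nsmul_eq_mul]

/-- The matrix `∑ e (x_e - p_e) H_e`. -/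
noncomputable def bernoulliMatrix {n : Type*} (p : E → ℝ) (H : E → Matrix n n ℝ) (x : E → Bool) :
    Matrix n n ℝ :=
  ∑ e, (boolVal (x e) - p e) • H e

omit [DecidableEq E] in
theorem bernoulliMatrix_isHermitian {n : Type*} (p : E → ℝ) {H : E → Matrix n n ℝ}
    (hH : ∀ e, (H e).IsHermitian) (x : E → Bool) : (bernoulliMatrix p H x).IsHermitian := by
  unfold bernoulliMatrix Matrix.IsHermitian
  rw [Matrix.conjTranspose_sum]
  refine Finset.sum_congr rfl fun e _ => ?_
  rw [Matrix.conjTranspose_smul, (hH e).eq]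
  simp

theorem bernoulliMatrix_update_sub {n : Type*} (p : E → ℝ) (H : E → Matrix n n ℝ) (x : E → Bool)
    (e : E) : bernoulliMatrix p H (Function.update x e true) -
      bernoulliMatrix p H (Function.update x e false) = H e := by
  unfold bernoulliMatrix
  rw [← Finset.sum_sub_distrib, Finset.sum_eq_single e]
  · rw [← sub_smul]; simp
  · intro f _ hf
    simp [Function.update_of_ne hf]
  · simp

/-- Recursion for the even trace moments of `∑ e (x_e - p_e) H_e`. -/
theorem IsBernoulliLaw.integral_trace_pow_succ_le (hμ : IsBernoulliLaw μ p) {n : Type*} [Fintype n]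
    [DecidableEq n] {H : E → Matrix n n ℝ} (hH : ∀ e, (H e).IsHermitian) (m : ℕ) :
    2 * ∫ x, (bernoulliMatrix p H x ^ (2 * (m + 1))).trace ∂μ ≤
      (2 * m + 1) * ∫ x, ∑ e, (boolVal (x e) + p e) *
        (H e * H e * bernoulliMatrix p H x ^ (2 * m)).trace ∂μ := by
  set W := bernoulliMatrix p H with hWdef
  have hW : ∀ x, (W x).IsHermitian := bernoulliMatrix_isHermitian p hH
  have h1 : ∀ x, (W x ^ (2 * (m + 1))).trace =
      ∑ e, (boolVal (x e) - p e) * (H e * W x ^ (2 * m + 1)).trace := by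
    intro x
    rw [show 2 * (m + 1) = (2 * m + 1) + 1 by ring, pow_succ']
    conv_lhs => enter [1, 1]; rw [hWdef]; unfold bernoulliMatrix
    rw [Finset.sum_mul, Matrix.trace_sum]
    refine Finset.sum_congr rfl fun e _ => ?_
    rw [Matrix.smul_mul, Matrix.trace_smul, smul_eq_mul]
  simp only [h1]
  rw [integral_finsetSum _ fun _ _ => integrable_boolFun μ _,
    integral_finsetSum _ fun _ _ => integrable_boolFun μ _, Finset.mul_sum, Finset.mul_sum]
  refine Finset.sum_le_sum fun e _ => ?_
  -- Flipping the coordinate e changes `W` by exactly `H e`, so the resulting difference of powers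
  -- telescopes.
  rw [hμ.integral_sub_mul e fun x => (H e * W x ^ (2 * m + 1)).trace]
  have hp := hμ.mem_Icc e
  set K : (E → Bool) → ℝ := fun x => (H e * H e * W x ^ (2 * m)).trace with hK
  have hK0 : ∀ x, 0 ≤ K x := fun x => Matrix.trace_sq_mul_pow_nonneg (hH e) (hW x) m
  have h2 : 2 * ∫ x, ((H e * W (Function.update x e true) ^ (2 * m + 1)).trace -
      (H e * W (Function.update x e false) ^ (2 * m + 1)).trace) ∂μ ≤
      (2 * m + 1) * (∫ x, K (Function.update x e true) ∂μ +
        ∫ x, K (Function.update x e false) ∂μ) := by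
    rw [← integral_add (integrable_boolFun μ _) (integrable_boolFun μ _), ← integral_const_mul,
      ← integral_const_mul]
    refine integral_mono (integrable_boolFun μ _) (integrable_boolFun μ _) fun x => ?_
    have h3 := Matrix.two_mul_sum_trace_le (hH e) (hW (Function.update x e true))
      (hW (Function.update x e false)) m
    refine le_of_eq_of_le ?_ h3
    change 2 * (_ - _) = _
    rw [← Matrix.trace_sub, ← Matrix.mul_sub, Matrix.pow_succ_sub_pow_succ,
      bernoulliMatrix_update_sub, Finset.mul_sum, Matrix.trace_sum]
    simp only [Matrix.mul_assoc]
  have hT := hμ.integral_true e K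
  have hF := hμ.integral_false e K
  have hT0 : 0 ≤ ∫ x, boolVal (x e) * K x ∂μ :=
    integral_nonneg fun x => mul_nonneg (boolVal_mem _).1 (hK0 x)
  have hF0 : 0 ≤ ∫ x, K x ∂μ := integral_nonneg hK0
  have hsplit : ∫ x, (1 - boolVal (x e)) * K x ∂μ =
      ∫ x, K x ∂μ - ∫ x, boolVal (x e) * K x ∂μ := by
    rw [← integral_sub (integrable_boolFun μ _) (integrable_boolFun μ _)]
    exact integral_congr_ae (Eventually.of_forall fun x => by ring)
  have hadd : ∫ x, (boolVal (x e) + p e) * K x ∂μ =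
      ∫ x, boolVal (x e) * K x ∂μ + p e * ∫ x, K x ∂μ := by
    rw [← integral_const_mul, ← integral_add (integrable_boolFun μ _) (integrable_boolFun μ _)]
    exact integral_congr_ae (Eventually.of_forall fun x => by ring)
  rw [hadd]
  have hpp : 0 ≤ p e * (1 - p e) := mul_nonneg hp.1 (by linarith [hp.2])
  calc _ = p e * (1 - p e) * (2 * ∫ x, ((H e * W (Function.update x e true) ^ (2 * m + 1)).trace -
      (H e * W (Function.update x e false) ^ (2 * m + 1)).trace) ∂μ) := by ring
    _ ≤ p e * (1 - p e) * ((2 * m + 1) * (∫ x, K (Function.update x e true) ∂μ +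
        ∫ x, K (Function.update x e false) ∂μ)) := mul_le_mul_of_nonneg_left h2 hpp
    _ = (2 * m + 1) * ((1 - p e) * (p e * ∫ x, K (Function.update x e true) ∂μ) +
        p e * ((1 - p e) * ∫ x, K (Function.update x e false) ∂μ)) := by ring
    _ ≤ _ := by
        refine mul_le_mul_of_nonneg_left ?_ (by positivity)
        rw [← hT, ← hF, hsplit]
        -- The two sides differ by 2p ∫ x_e K ≥ 0.
        nlinarith [mul_nonneg hp.1 hT0]

end Bernoulli

/-! ### Symmetric noise matrices indexed by vertex pairs -/

/-- Unordered pairs of vertices, represented by ordered pairs `a ≤ b`. -/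
abbrev VertexPair (N : ℕ) : Type := {p : Fin N × Fin N // p.1 ≤ p.2}

/-- The unordered pair of two vertices. -/
def pairOf {N : ℕ} (a b : Fin N) : VertexPair N := ⟨(min a b, max a b), min_le_max⟩

theorem pairOf_comm {N : ℕ} (a b : Fin N) : pairOf a b = pairOf b a := by
  simp [pairOf, min_comm, max_comm]

theorem pairOf_eq_iff {N : ℕ} {a b c d : Fin N} :
    pairOf a b = pairOf c d ↔ (a = c ∧ b = d) ∨ (a = d ∧ b = c) := by
  simp only [pairOf, Subtype.mk.injEq, Prod.mk.injEq]
  constructor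
  · rintro ⟨h1, h2⟩
    rcases le_total a b with hab | hab <;> rcases le_total c d with hcd | hcd <;>
      simp_all
  · rintro (⟨rfl, rfl⟩ | ⟨rfl, rfl⟩)
    · exact ⟨rfl, rfl⟩
    · exact ⟨min_comm _ _, max_comm _ _⟩

theorem pairOf_injective {N : ℕ} (a : Fin N) : Function.Injective (pairOf a) := by
  intro b c h
  rcases pairOf_eq_iff.1 h with h | h
  · exact h.2
  · rw [h.2, h.1]

/-- The symmetric 0-1 matrix with support an unordered pair of indices. -/
def pairMatrix {N : ℕ} (e : VertexPair N) : Matrix (Fin N) (Fin N) ℝ :=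
  Matrix.of fun a b => if pairOf a b = e then 1 else 0

theorem pairMatrix_isHermitian {N : ℕ} (e : VertexPair N) : (pairMatrix e).IsHermitian := by
  ext a b
  simp [pairMatrix, pairOf_comm]

theorem bernoulliMatrix_pairMatrix_apply {N : ℕ} (p : VertexPair N → ℝ) (x : VertexPair N → Bool)
    (a b : Fin N) : bernoulliMatrix p pairMatrix x a b =
      boolVal (x (pairOf a b)) - p (pairOf a b) := by
  simp [bernoulliMatrix, pairMatrix, Matrix.sum_apply]

/-- The square of `pairMatrix e` is the diagonal projection onto the endpoints of e, so the weighted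
sum of squares is the diagonal matrix of weighted degrees. -/
theorem sum_mul_trace_pairMatrix {N : ℕ} (c : VertexPair N → ℝ) (Y : Matrix (Fin N) (Fin N) ℝ) :
    ∑ e, c e * (pairMatrix e * pairMatrix e * Y).trace =
      ∑ a, (∑ b, c (pairOf a b)) * Y a a := by
  have h1 : ∀ a d, (∑ e, c e • (pairMatrix e * pairMatrix e)) a d =
      if a = d then ∑ b, c (pairOf a b) else 0 := by
    intro a d
    rw [Matrix.sum_apply]
    simp only [Matrix.smul_apply, Matrix.mul_apply, pairMatrix, Matrix.of_apply, smul_eq_mul]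
    simp only [Finset.mul_sum]
    rw [Finset.sum_comm]
    have h2 : ∀ b, ∑ e, c e * ((if pairOf a b = e then (1 : ℝ) else 0) *
        (if pairOf b d = e then 1 else 0)) = if a = d then c (pairOf a b) else 0 := by
      intro b
      rw [Finset.sum_eq_single (pairOf a b)]
      · rw [if_pos rfl, one_mul, pairOf_comm a b]
        by_cases h : a = d
        · subst h; simp
        · rw [if_neg h, if_neg, mul_zero]
          intro h'
          exact h (pairOf_injective b h').symm
      · intro e _ he
        rw [if_neg he.symm]; ring
      · simp
    simp only [h2]
    split_ifs <;> simp
  have h3 : ∑ e, c e * (pairMatrix e * pairMatrix e * Y).trace =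
      ((∑ e, c e • (pairMatrix e * pairMatrix e)) * Y).trace := by
    rw [Finset.sum_mul, Matrix.trace_sum]
    refine Finset.sum_congr rfl fun e _ => ?_
    rw [Matrix.smul_mul, Matrix.trace_smul, smul_eq_mul]
  rw [h3, Matrix.trace]
  refine Finset.sum_congr rfl fun a _ => ?_
  simp only [Matrix.diag, Matrix.mul_apply, h1]
  simp

theorem Matrix.abs_pow_apply_le {N : ℕ} {W : Matrix (Fin N) (Fin N) ℝ} (hW : ∀ a b, |W a b| ≤ 1)
    (q : ℕ) (a b : Fin N) : |(W ^ q) a b| ≤ (N : ℝ) ^ q := by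
  induction q generalizing a b with
  | zero =>
    rw [pow_zero, pow_zero, Matrix.one_apply]
    split_ifs <;> simp
  | succ q ih =>
    rw [pow_succ, Matrix.mul_apply]
    calc _ ≤ ∑ c : Fin N, (N : ℝ) ^ q * 1 := by
          refine (Finset.abs_sum_le_sum_abs _ _).trans (Finset.sum_le_sum fun c _ => ?_)
          rw [abs_mul]
          exact mul_le_mul (ih a c) (hW c b) (abs_nonneg _) (by positivity)
      _ = _ := by
          rw [Finset.sum_const, Finset.card_univ, Fintype.card_fin, nsmul_eq_mul, pow_succ]; ring

theorem Matrix.IsHermitian.pow_two_mul_apply_self_nonneg {N : ℕ} {W : Matrix (Fin N) (Fin N) ℝ}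
    (hW : W.IsHermitian) (m : ℕ) (a : Fin N) : 0 ≤ (W ^ (2 * m)) a a := by
  rw [two_mul, pow_add, Matrix.mul_apply]
  refine Finset.sum_nonneg fun b _ => ?_
  have h := (hW.pow m).apply a b
  rw [star_trivial] at h
  rw [h]
  exact mul_self_nonneg _

/-! ### Norm and quadratic form of the noise -/

section Noise

variable {N : ℕ} {μ : Measure (VertexPair N → Bool)} [IsProbabilityMeasure μ]
  {p : VertexPair N → ℝ} {s : ℝ}

theorem abs_noise_apply_le (hμ : IsBernoulliLaw μ p) (x : VertexPair N → Bool) (a b : Fin N) :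
    |bernoulliMatrix p pairMatrix x a b| ≤ 1 := by
  rw [bernoulliMatrix_pairMatrix_apply, abs_le]
  have h1 := hμ.mem_Icc (pairOf a b)
  have h2 := boolVal_mem (x (pairOf a b))
  constructor <;> linarith

/-- The exponential moment of a degree is at most exp(2Ns), since its mean is at most Ns. The
threshold 4Ns leaves exp(-2Ns), used as a smooth substitute for the probability of a large degree.
-/
theorem integral_exp_degree_le (hμ : IsBernoulliLaw μ p) (hp : ∀ e, p e ≤ s) (a : Fin N) :
    ∫ x, Real.exp (∑ b, boolVal (x (pairOf a b)) - 4 * (N * s)) ∂μ ≤ Real.exp (-(2 * (N * s))) := by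
  have h1 := hμ.integral_exp_sum_le (Finset.univ.image (pairOf a))
  simp only [Finset.sum_image (pairOf_injective a).injOn] at h1
  have h2 : ∑ b, p (pairOf a b) ≤ N * s := by
    refine (Finset.sum_le_sum fun b _ => hp _).trans (le_of_eq ?_)
    simp
  simp only [sub_eq_add_neg, Real.exp_add]
  rw [integral_mul_const]
  calc _ ≤ Real.exp (2 * ∑ b, p (pairOf a b)) * Real.exp (-(4 * (N * s))) :=
        mul_le_mul_of_nonneg_right h1 (Real.exp_pos _).le
    _ ≤ _ := by
        rw [← Real.exp_add]
        exact Real.exp_le_exp.2 (by linarith)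

/-- Even trace moments of the noise matrix. -/
theorem integral_trace_noise_pow_le (hμ : IsBernoulliLaw μ p) (hp : ∀ e, p e ≤ s) {q : ℕ}
    (hN : 0 < N) (hs : 1 ≤ N * s)
    (hq : 2 * (N : ℝ) ^ (2 * q) * Real.exp (-(2 * (N * s))) ≤ 1) {m : ℕ} (hm : m ≤ q) :
    ∫ x, (bernoulliMatrix p pairMatrix x ^ (2 * m)).trace ∂μ ≤ N * (10 * q * (N * s)) ^ m := by
  have hN1 : (1 : ℝ) ≤ N := by exact_mod_cast hN
  induction m with
  | zero => simp [Matrix.trace]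
  | succ m ih =>
    have ih := ih (by omega)
    set W := bernoulliMatrix p pairMatrix with hWdef
    have hW : ∀ x, (W x).IsHermitian := bernoulliMatrix_isHermitian p pairMatrix_isHermitian
    have h1 := hμ.integral_trace_pow_succ_le (H := pairMatrix) pairMatrix_isHermitian m
    rw [← hWdef] at h1
    have hpt : ∀ x, ∑ e, (boolVal (x e) + p e) *
        (pairMatrix e * pairMatrix e * W x ^ (2 * m)).trace ≤
        5 * (N * s) * (W x ^ (2 * m)).trace + 2 * (N : ℝ) ^ (2 * m + 1) *
          ∑ a, Real.exp (∑ b, boolVal (x (pairOf a b)) - 4 * (N * s)) := by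
      intro x
      rw [sum_mul_trace_pairMatrix fun e => boolVal (x e) + p e, Matrix.trace, Finset.mul_sum,
        Finset.mul_sum, ← Finset.sum_add_distrib]
      refine Finset.sum_le_sum fun a _ => ?_
      have hY := (hW x).pow_two_mul_apply_self_nonneg m a
      have hY' := (le_abs_self _).trans (Matrix.abs_pow_apply_le (abs_noise_apply_le hμ x) (2 * m) a a)
      have hp' : ∑ b, p (pairOf a b) ≤ N * s := by
        refine (Finset.sum_le_sum fun b _ => hp _).trans (le_of_eq ?_)
        simp
      rw [Finset.sum_add_distrib]
      -- If the degree is at most 4Ns, the weight is at most 4Ns + Ns. Otherwise the exponential is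
      -- at least 1 and pays for the crude bound 2N · N^(2m).
      rcases le_or_gt (∑ b, boolVal (x (pairOf a b))) (4 * (N * s)) with h | h
      · refine (mul_le_mul_of_nonneg_right (by linarith : _ ≤ 5 * (N * s)) hY).trans ?_
        have : 0 ≤ 2 * (N : ℝ) ^ (2 * m + 1) *
          Real.exp (∑ b, boolVal (x (pairOf a b)) - 4 * (N * s)) := by positivity
        simpa using this
      · have h2 : (1 : ℝ) ≤ Real.exp (∑ b, boolVal (x (pairOf a b)) - 4 * (N * s)) :=
          Real.one_le_exp (by linarith)
        have h3 : ∑ b, boolVal (x (pairOf a b)) + ∑ b, p (pairOf a b) ≤ 2 * N := by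
          have a1 : ∑ b, boolVal (x (pairOf a b)) ≤ N := by
            refine (Finset.sum_le_sum fun b _ => (boolVal_mem _).2).trans (le_of_eq ?_)
            simp
          have a2 : ∑ b, p (pairOf a b) ≤ N := by
            refine (Finset.sum_le_sum fun b _ => (hμ.mem_Icc _).2).trans (le_of_eq ?_)
            simp
          linarith
        have h4 : (∑ b, boolVal (x (pairOf a b)) + ∑ b, p (pairOf a b)) * (W x ^ (2 * m)) a a ≤
            2 * N * (N : ℝ) ^ (2 * m) :=
          mul_le_mul h3 hY' hY (by positivity)
        have h5 : 2 * N * (N : ℝ) ^ (2 * m) ≤ 2 * (N : ℝ) ^ (2 * m + 1) *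
            Real.exp (∑ b, boolVal (x (pairOf a b)) - 4 * (N * s)) := by
          calc 2 * N * (N : ℝ) ^ (2 * m) = 2 * (N : ℝ) ^ (2 * m + 1) * 1 := by ring
            _ ≤ _ := mul_le_mul_of_nonneg_left h2 (by positivity)
        have h6 : 0 ≤ 5 * (N * s) * (W x ^ (2 * m)) a a := by positivity
        simp only [Matrix.diag]
        linarith
    have h2 := integral_mono (integrable_boolFun μ _) (integrable_boolFun μ _) hpt
    rw [integral_add (integrable_boolFun μ _) (integrable_boolFun μ _), integral_const_mul,
      integral_const_mul] at h2
    have hswap : ∫ x, ∑ a, Real.exp (∑ b, boolVal (x (pairOf a b)) - 4 * (N * s)) ∂μ =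
        ∑ a, ∫ x, Real.exp (∑ b, boolVal (x (pairOf a b)) - 4 * (N * s)) ∂μ :=
      integral_finsetSum _ fun _ _ => integrable_boolFun μ _
    rw [hswap] at h2
    have h3 : 2 * (N : ℝ) ^ (2 * m + 1) * ∑ a : Fin N,
        ∫ x, Real.exp (∑ b, boolVal (x (pairOf a b)) - 4 * (N * s)) ∂μ ≤ 1 := by
      calc _ ≤ 2 * (N : ℝ) ^ (2 * m + 1) * ∑ a : Fin N, Real.exp (-(2 * (N * s))) :=
            mul_le_mul_of_nonneg_left
              (Finset.sum_le_sum fun a _ => integral_exp_degree_le hμ hp a) (by positivity)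
        _ = 2 * (N : ℝ) ^ (2 * (m + 1)) * Real.exp (-(2 * (N * s))) := by
            rw [Finset.sum_const, Finset.card_univ, Fintype.card_fin, nsmul_eq_mul]; ring
        _ ≤ 2 * (N : ℝ) ^ (2 * q) * Real.exp (-(2 * (N * s))) := by
            refine mul_le_mul_of_nonneg_right (mul_le_mul_of_nonneg_left
              (pow_le_pow_right₀ hN1 (by omega)) (by norm_num)) (Real.exp_pos _).le
        _ ≤ 1 := hq
    set I := ∫ x, (W x ^ (2 * m)).trace ∂μ with hI
    have hmq : ((m : ℝ) + 1) ≤ q := by exact_mod_cast hm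
    have h4 : (1 : ℝ) ≤ N * (10 * q * (N * s)) ^ m := by
      have : (1 : ℝ) ≤ (10 * q * (N * s)) ^ m := by
        apply one_le_pow₀
        nlinarith [Nat.cast_nonneg (α := ℝ) m]
      nlinarith
    have h5 : 5 * (N * s) * I ≤ 5 * (N * s) * (N * (10 * q * (N * s)) ^ m) :=
      mul_le_mul_of_nonneg_left ih (by linarith)
    set Z := (N : ℝ) * (10 * q * (N * s)) ^ m with hZ
    -- The rare-event term is at most 1 ≤ 5NsZ, which doubles 5Ns to 10Ns. The recursion factor (2m
    -- + 1)/2 is at most q.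
    have h7 : ∫ x, (W x ^ (2 * (m + 1))).trace ∂μ ≤ (2 * m + 1) / 2 * (10 * (N * s) * Z) := by
      have : (2 * m + 1) * (∫ x, ∑ e, (boolVal (x e) + p e) *
          (pairMatrix e * pairMatrix e * W x ^ (2 * m)).trace ∂μ) ≤
          (2 * m + 1) * (10 * (N * s) * Z) :=
        mul_le_mul_of_nonneg_left (by nlinarith) (by positivity)
      linarith
    refine h7.trans ?_
    rw [pow_succ, ← mul_assoc (N : ℝ), ← hZ]
    have h8 : 0 ≤ 10 * (N * s) * Z := by positivity
    calc (2 * (m : ℝ) + 1) / 2 * (10 * (N * s) * Z) ≤ q * (10 * (N * s) * Z) :=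
          mul_le_mul_of_nonneg_right (by linarith) h8
      _ = _ := by ring

/-- Markov's inequality on a finite boolean cube. -/
theorem measureReal_lt_le_integral_div {E : Type*} [Finite E] (μ : Measure (E → Bool))
    [IsProbabilityMeasure μ] {G : (E → Bool) → ℝ} (hG : ∀ x, 0 ≤ G x) {t : ℝ} (ht : 0 < t) :
    μ.real {x | t < G x} ≤ (∫ x, G x ∂μ) / t := by
  rw [le_div_iff₀ ht, mul_comm]
  refine (mul_le_mul_of_nonneg_left ?_ ht.le).trans
    (mul_meas_ge_le_integral_of_nonneg (Eventually.of_forall hG) (integrable_boolFun μ G) t)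
  exact measureReal_mono fun x (hx : t < G x) => hx.le

/-- The operator norm of the noise matrix. -/
theorem measureReal_noise_norm_le (hμ : IsBernoulliLaw μ p) (hp : ∀ e, p e ≤ s) {q : ℕ}
    (hN : 0 < N) (hs : 1 ≤ N * s) (hq0 : q ≠ 0)
    (hq : 2 * (N : ℝ) ^ (2 * q) * Real.exp (-(2 * (N * s))) ≤ 1) {t : ℝ} (ht : 0 < t) :
    μ.real {x | ¬ ∀ y, ‖Matrix.toEuclideanLin (bernoulliMatrix p pairMatrix x) y‖ ≤ t * ‖y‖} ≤
      N * (10 * q * (N * s) / t ^ 2) ^ q := by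
  have hW : ∀ x, (bernoulliMatrix p pairMatrix x).IsHermitian :=
    bernoulliMatrix_isHermitian p pairMatrix_isHermitian
  calc _ ≤ μ.real {x | t ^ (2 * q) < (bernoulliMatrix p pairMatrix x ^ (2 * q)).trace} := by
        refine measureReal_mono fun x hx => ?_
        by_contra h
        exact hx ((hW x).norm_toEuclideanLin_le hq0 ht.le (not_lt.1 h))
    _ ≤ (∫ x, (bernoulliMatrix p pairMatrix x ^ (2 * q)).trace ∂μ) / t ^ (2 * q) :=
        measureReal_lt_le_integral_div μ (fun x => Finset.sum_nonneg fun a _ =>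
          (hW x).pow_two_mul_apply_self_nonneg q a) (by positivity)
    _ ≤ N * (10 * q * (N * s)) ^ q / t ^ (2 * q) :=
        div_le_div_of_nonneg_right (integral_trace_noise_pow_le hμ hp hN hs hq le_rfl)
          (by positivity)
    _ = _ := by rw [div_pow, ← pow_mul, mul_div_assoc]

/-- The noise matrix applied to a delocalised vector. -/
theorem integral_norm_sq_noise_le (hμ : IsBernoulliLaw μ p) (hp : ∀ e, p e ≤ s) {m : ℝ}
    (u : EuclideanSpace ℝ (Fin N)) (hu : ∀ a, |u a| ≤ m) :
    ∫ x, ‖Matrix.toEuclideanLin (bernoulliMatrix p pairMatrix x) u‖ ^ 2 ∂μ ≤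
      N * (N * (2 * (m ^ 2 * s))) := by
  have h1 : ∀ x, ‖Matrix.toEuclideanLin (bernoulliMatrix p pairMatrix x) u‖ ^ 2 =
      ∑ a, (∑ b, u b * (boolVal (x (pairOf a b)) - p (pairOf a b))) ^ 2 := by
    intro x
    rw [EuclideanSpace.real_norm_sq_eq]
    refine Finset.sum_congr rfl fun a _ => ?_
    congr 1
    simp only [Matrix.toLpLin_apply, Matrix.mulVec, dotProduct,
      bernoulliMatrix_pairMatrix_apply]
    exact Finset.sum_congr rfl fun b _ => mul_comm _ _
  simp only [h1]
  rw [integral_finsetSum _ fun _ _ => integrable_boolFun μ _]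
  calc _ ≤ ∑ a : Fin N, N * (2 * (m ^ 2 * s)) := by
        refine Finset.sum_le_sum fun a _ => ?_
        -- Within one row each pair occurs once.
        have := hμ.integral_sq_sum_le (pairOf a) (fun b => by
          refine (Finset.card_le_one.2 fun c hc d hd => ?_).trans one_le_two
          simp only [Finset.mem_filter, Finset.mem_univ, true_and] at hc hd
          exact pairOf_injective a (hc.trans hd.symm)) (fun b => u b) hu hp
        simpa using this
    _ = _ := by simp

/-- The quadratic form of the noise matrix at delocalised vectors. -/
theorem integral_sq_inner_noise_le (hμ : IsBernoulliLaw μ p) (hp : ∀ e, p e ≤ s) {m : ℝ}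
    (u w : EuclideanSpace ℝ (Fin N)) (hu : ∀ a, |u a| ≤ m) (hw : ∀ a, |w a| ≤ m) :
    ∫ x, inner ℝ u (Matrix.toEuclideanLin (bernoulliMatrix p pairMatrix x) w) ^ 2 ∂μ ≤
      N * N * (2 * ((m * m) ^ 2 * s)) := by
  have h1 : ∀ x, inner ℝ u (Matrix.toEuclideanLin (bernoulliMatrix p pairMatrix x) w) =
      ∑ c : Fin N × Fin N, u c.1 * w c.2 *
        (boolVal (x (pairOf c.1 c.2)) - p (pairOf c.1 c.2)) := by
    intro x
    rw [Fintype.sum_prod_type, PiLp.inner_apply]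
    refine Finset.sum_congr rfl fun a _ => ?_
    simp only [Matrix.toLpLin_apply, Matrix.mulVec, dotProduct,
      bernoulliMatrix_pairMatrix_apply, RCLike.inner_apply, conj_trivial]
    rw [Finset.sum_mul]
    exact Finset.sum_congr rfl fun b _ => by ring
  simp only [h1]
  -- In the quadratic form a pair occurs at most twice, as (a, b) and as (b, a).
  have := hμ.integral_sq_sum_le (fun c : Fin N × Fin N => pairOf c.1 c.2) (fun c => by
      refine (Finset.card_le_card (t := {c, c.swap}) fun d hd => ?_).trans Finset.card_le_two
      simp only [Finset.mem_filter, Finset.mem_univ, true_and] at hd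
      simp only [Finset.mem_insert, Finset.mem_singleton]
      rcases pairOf_eq_iff.1 hd with h | h
      · exact Or.inl (Prod.ext h.1 h.2)
      · exact Or.inr (Prod.ext h.1 h.2)) (fun c => u c.1 * w c.2) (m := m * m) (fun c => by
      rw [abs_mul]
      exact mul_le_mul (hu _) (hw _) (abs_nonneg _) ((abs_nonneg _).trans (hu c.1))) hp
  simpa using this

end Noise

/-! ### The adjacency matrix as signal plus noise -/

theorem discretize_apply (g : ℝ → ℝ) (N : ℕ) (a : Fin N) :
    discretize g N a = (√(N : ℝ))⁻¹ * g (((a : ℕ) + 1 : ℝ) / N) := rfl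

theorem discretize_apply_mul (g h : ℝ → ℝ) {N : ℕ} (a b : Fin N) :
    discretize g N a * discretize h N b =
      (N : ℝ)⁻¹ * (g (((a : ℕ) + 1 : ℝ) / N) * h (((b : ℕ) + 1 : ℝ) / N)) := by
  have : (√(N : ℝ))⁻¹ * (√(N : ℝ))⁻¹ = (N : ℝ)⁻¹ := by
    rw [← mul_inv, Real.mul_self_sqrt (Nat.cast_nonneg N)]
  rw [discretize_apply, discretize_apply, ← this]; ring

theorem abs_discretize_apply_le {g : ℝ → ℝ} {R : ℝ} (hg : ∀ x ∈ Icc (0 : ℝ) 1, |g x| ≤ R) {N : ℕ}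
    (a : Fin N) : |discretize g N a| ≤ (√(N : ℝ))⁻¹ * R := by
  rw [discretize_apply, abs_mul, abs_of_nonneg (by positivity)]
  exact mul_le_mul_of_nonneg_left (hg _ (mem_Icc_grid a)) (by positivity)

section Model

variable {k : ℕ} {f : ℝ → ℝ → ℝ} {θ : Fin k → ℝ} {r : Fin k → ℝ → ℝ}

theorem IsSpectralKernel.symm (hf : IsSpectralKernel f θ r) {x y : ℝ} (hx : x ∈ Icc (0 : ℝ) 1)
    (hy : y ∈ Icc (0 : ℝ) 1) : f x y = f y x := by
  rw [hf.decomp x hx y hy, hf.decomp y hy x hx]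
  exact Finset.sum_congr rfl fun i _ => by ring

theorem IsSpectralKernel.exists_le (hf : IsSpectralKernel f θ r) (hF2 : AssumptionF2 r) :
    ∃ F : ℝ, 0 < F ∧ ∀ x ∈ Icc (0 : ℝ) 1, ∀ y ∈ Icc (0 : ℝ) 1, f x y ≤ F := by
  obtain ⟨R, hR0, hR⟩ := hF2.exists_bound
  have h0 : 0 ≤ ∑ i, θ i * R * R :=
    Finset.sum_nonneg fun i _ => mul_nonneg (mul_nonneg (hf.pos i).le hR0) hR0
  refine ⟨∑ i, θ i * R * R + 1, by linarith, fun x hx y hy => ?_⟩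
  rw [hf.decomp x hx y hy]
  suffices ∑ i, θ i * r i x * r i y ≤ ∑ i, θ i * R * R by linarith
  refine Finset.sum_le_sum fun i _ => ?_
  rw [mul_assoc, mul_assoc]
  refine mul_le_mul_of_nonneg_left ((le_abs_self _).trans ?_) (hf.pos i).le
  rw [abs_mul]
  exact mul_le_mul (hR i x hx).1 (hR i y hy).1 (abs_nonneg _) hR0

/-- Signal plus noise decomposition of the adjacency matrix. -/
theorem IsInhomERAdjacency.exists_noise (hf : IsSpectralKernel f θ r) {F : ℝ}
    (hF : ∀ x ∈ Icc (0 : ℝ) 1, ∀ y ∈ Icc (0 : ℝ) 1, f x y ≤ F)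
    {Ω : Type*} [MeasurableSpace Ω] {P : Measure Ω} [IsProbabilityMeasure P] {ε : ℝ} (hε : 0 ≤ ε)
    {N : ℕ} (hN : 0 < N) {M : Ω → Matrix (Fin N) (Fin N) ℝ} (hM : IsInhomERAdjacency P f ε N M) :
    ∃ (p : VertexPair N → ℝ) (B : Ω → VertexPair N → Bool), Measurable B ∧
      IsBernoulliLaw (P.map B) p ∧ (∀ e, p e ≤ ε * F) ∧
      ∀ ω x, Matrix.toEuclideanLin (M ω) x = (N * ε) •
        ∑ l, (θ l * inner ℝ (discretize (r l) N) x) • discretize (r l) N +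
        Matrix.toEuclideanLin (bernoulliMatrix p pairMatrix (B ω)) x := by
  have hN' : (N : ℝ) ≠ 0 := by exact_mod_cast hN.ne'
  set t : Fin N → ℝ := fun a => ((a : ℕ) + 1 : ℝ) / N with ht
  have hti : ∀ a, t a ∈ Icc (0 : ℝ) 1 := mem_Icc_grid
  set p : VertexPair N → ℝ := fun e => ε * f (t e.1.1) (t e.1.2) with hp
  set B : Ω → VertexPair N → Bool := fun ω e => decide (M ω e.1.1 e.1.2 = 1) with hB
  have hdec : Measurable fun y : ℝ => decide (y = 1) :=
    measurable_to_bool (by simp [preimage])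
  have hBm : ∀ e, Measurable fun ω => B ω e := fun e => hdec.comp (hM.measurable _ _)
  have hval : ∀ ω e, boolVal (B ω e) = M ω e.1.1 e.1.2 := by
    intro ω e
    rcases hM.zero_or_one ω e.1.1 e.1.2 with h | h <;> simp [hB, h]
  have hMB : ∀ ω a b, M ω a b = boolVal (B ω (pairOf a b)) := by
    intro ω a b
    rw [hval]
    rcases le_total a b with h | h
    · simp [pairOf, h]
    · have := (hM.isHermitian ω).apply a b
      simpa [pairOf, h] using this.symm
  have hpp : ∀ a b, p (pairOf a b) = ε * f (t a) (t b) := by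
    intro a b
    rcases le_total a b with h | h
    · simp [hp, pairOf, h]
    · simp only [hp, pairOf, h, min_eq_right, max_eq_left]
      rw [hf.symm (hti b) (hti a)]
  refine ⟨p, B, measurable_pi_lambda _ hBm, ?_, fun e =>
    mul_le_mul_of_nonneg_left (hF _ (hti _) _ (hti _)) hε, ?_⟩
  · refine isBernoulliLaw_map hBm ?_ fun e => ?_
    · exact hM.indep.comp (fun _ y => decide (y = 1)) fun _ => hdec
    · have h1 : (fun ω => boolVal (B ω e)) = indicator {ω | M ω e.1.1 e.1.2 = 1} 1 := by
        funext ω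
        by_cases h : M ω e.1.1 e.1.2 = 1 <;> simp [hB, h, indicator]
      have hS : MeasurableSet {ω | M ω e.1.1 e.1.2 = 1} :=
        hM.measurable _ _ (measurableSet_singleton 1)
      rw [h1, integral_indicator_one hS,
        measureReal_def, hM.prob_one _ _ e.2, ENNReal.toReal_ofReal]
      exact mul_nonneg hε (hf.nonneg _ (hti _) _ (hti _))
  · intro ω x
    ext a
    simp only [PiLp.add_apply, PiLp.smul_apply, Matrix.toLpLin_apply, Matrix.mulVec, dotProduct,
      bernoulliMatrix_pairMatrix_apply, smul_eq_mul, WithLp.ofLp_sum, Finset.sum_apply,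
      WithLp.ofLp_smul, Pi.smul_apply, hMB, hpp]
    have h1 : ∀ l, θ l * inner ℝ (discretize (r l) N) x * discretize (r l) N a =
        ∑ b, (N : ℝ)⁻¹ * (θ l * r l (t a) * r l (t b)) * x b := by
      intro l
      rw [PiLp.inner_apply, Finset.mul_sum, Finset.sum_mul]
      refine Finset.sum_congr rfl fun b _ => ?_
      have := discretize_apply_mul (r l) (r l) a b
      simp only [RCLike.inner_apply, conj_trivial]
      calc _ = θ l * x b * (discretize (r l) N a * discretize (r l) N b) := by ring
        _ = _ := by rw [this]; ring
    simp only [h1]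
    rw [Finset.sum_comm, Finset.mul_sum, ← Finset.sum_add_distrib]
    refine Finset.sum_congr rfl fun b _ => ?_
    rw [← Finset.sum_mul, ← Finset.mul_sum, ← hf.decomp _ (hti a) _ (hti b)]
    field_simp
    ring

/-- The event that the noise is under control. -/
def IsControlledNoise {N k : ℕ} (W : EuclideanSpace ℝ (Fin N) →ₗ[ℝ] EuclideanSpace ℝ (Fin N))
    (e : Fin k → EuclideanSpace ℝ (Fin N)) (δ L T : ℝ) : Prop :=
  (∀ y, ‖W y‖ ≤ δ * T * ‖y‖) ∧ (∀ j, ‖W (e j)‖ ≤ L * √T) ∧ ∀ j l, |inner ℝ (e j) (W (e l))| ≤ L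

/-- The probability that the noise is not under control. -/
theorem measureReal_not_isControlledNoise_le {N : ℕ} {μ : Measure (VertexPair N → Bool)}
    [IsProbabilityMeasure μ] {p : VertexPair N → ℝ} (hμ : IsBernoulliLaw μ p) {R F ε δ L : ℝ}
    (hR : ∀ i, ∀ x ∈ Icc (0 : ℝ) 1, |r i x| ≤ R) (hp : ∀ e, p e ≤ ε * F)
    (hN : 0 < N) (hε : 0 < ε) (hs : 1 ≤ N * (ε * F)) {q : ℕ} (hq0 : q ≠ 0)
    (hq : 2 * (N : ℝ) ^ (2 * q) * Real.exp (-(2 * (N * (ε * F)))) ≤ 1) (hδ : 0 < δ) (hL : 0 < L) :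
    μ.real {x | ¬ IsControlledNoise (Matrix.toEuclideanLin (bernoulliMatrix p pairMatrix x))
      (fun l => discretize (r l) N) δ L (N * ε)} ≤
      N * (10 * q * (N * (ε * F)) / (δ * (N * ε)) ^ 2) ^ q +
        (k * (2 * R ^ 2 * F) + k * k * (2 * R ^ 4 * F * ε)) / L ^ 2 := by
  set W := fun x => Matrix.toEuclideanLin (bernoulliMatrix p pairMatrix x) with hW
  set e : Fin k → EuclideanSpace ℝ (Fin N) := fun l => discretize (r l) N with he
  have hN' : (0 : ℝ) < N := by exact_mod_cast hN
  have hT : 0 < N * ε := mul_pos hN' hε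
  set m := (√(N : ℝ))⁻¹ * R with hm
  have hm2 : m ^ 2 = R ^ 2 / N := by
    rw [hm, mul_pow, inv_pow, Real.sq_sqrt hN'.le]; ring
  have hem : ∀ l a, |e l a| ≤ m := fun l a => abs_discretize_apply_le (hR l) a
  have hsub : {x | ¬ IsControlledNoise (W x) e δ L (N * ε)} ⊆
      {x | ¬ ∀ y, ‖W x y‖ ≤ δ * (N * ε) * ‖y‖} ∪
      ((⋃ j, {x | L ^ 2 * (N * ε) < ‖W x (e j)‖ ^ 2}) ∪
        ⋃ c : Fin k × Fin k, {x | L ^ 2 < inner ℝ (e c.1) (W x (e c.2)) ^ 2}) := by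
    intro x hx
    by_contra hcon
    simp only [mem_union, mem_iUnion, mem_ofPred_eq, not_or, not_exists, not_not, not_lt] at hcon
    refine hx ⟨hcon.1, fun j => ?_, fun j l => ?_⟩
    · refine le_of_sq_le_sq ?_ (by positivity)
      rw [mul_pow, Real.sq_sqrt hT.le]
      exact hcon.2.1 j
    · exact abs_le_of_sq_le_sq (hcon.2.2 (j, l)) hL.le
  have h1 := measureReal_noise_norm_le hμ hp hN hs hq0 hq (mul_pos hδ hT)
  -- Chebyshev with entries of size R/√N: E‖W e_j‖² ≤ 2R²F · Nε, and below E(e_j'W e_l)² ≤ 2R⁴Fε.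
  have h2 : ∀ j, μ.real {x | L ^ 2 * (N * ε) < ‖W x (e j)‖ ^ 2} ≤ 2 * R ^ 2 * F / L ^ 2 := by
    intro j
    refine (measureReal_lt_le_integral_div μ (fun x => sq_nonneg _) (by positivity)).trans ?_
    refine (div_le_div_of_nonneg_right (integral_norm_sq_noise_le hμ hp (e j) (hem j))
      (by positivity)).trans (le_of_eq ?_)
    rw [hm2]
    field_simp
  have h3 : ∀ c : Fin k × Fin k, μ.real {x | L ^ 2 < inner ℝ (e c.1) (W x (e c.2)) ^ 2} ≤
      2 * R ^ 4 * F * ε / L ^ 2 := by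
    intro c
    refine (measureReal_lt_le_integral_div μ (fun x => sq_nonneg _) (by positivity)).trans ?_
    refine (div_le_div_of_nonneg_right
      (integral_sq_inner_noise_le hμ hp (e c.1) (e c.2) (hem _) (hem _))
      (by positivity)).trans (le_of_eq ?_)
    rw [← sq m, hm2]
    field_simp
  refine (measureReal_mono hsub).trans ((measureReal_union_le _ _).trans (add_le_add h1 ?_))
  refine (measureReal_union_le _ _).trans ?_
  rw [add_div]
  refine add_le_add ((measureReal_iUnion_fintype_le _).trans ?_)
    ((measureReal_iUnion_fintype_le _).trans ?_)
  · refine (Finset.sum_le_sum fun j _ => h2 j).trans (le_of_eq ?_)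
    simp [mul_div_assoc]
  · refine (Finset.sum_le_sum fun c _ => h3 c).trans (le_of_eq ?_)
    simp [mul_div_assoc, Fintype.card_prod]

end Model

/-! ### Choice of the moment order -/

theorem AssumptionE1.eventually_sq_log_le {ε : ℕ → ℝ} (h : AssumptionE1 ε)
    (hε : ∀ N, 1 ≤ N → 0 < ε N) {c : ℝ} (hc : 0 < c) :
    ∀ᶠ N : ℕ in atTop, 1 ≤ Real.log N ∧ Real.log N ^ 2 ≤ c * (N * ε N) := by
  obtain ⟨⟨ξ, hξ, hlim⟩, -⟩ := h
  filter_upwards [hlim.eventually_lt_const hc, eventually_ge_atTop 3] with N h1 h2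
  have hN : (3 : ℝ) ≤ N := by exact_mod_cast h2
  have hlog : 1 ≤ Real.log N := by
    rw [Real.le_log_iff_exp_le (by linarith)]
    linarith [Real.exp_one_lt_d9]
  have hT : 0 < N * ε N := mul_pos (by linarith) (hε N (by omega))
  refine ⟨hlog, ?_⟩
  have h3 : Real.log N ^ 2 ≤ Real.log N ^ ξ := by
    rw [← Real.rpow_natCast]
    exact Real.rpow_le_rpow_of_exponent_le hlog (by norm_num; linarith)
  rw [one_div, inv_mul_lt_iff₀ hT] at h1
  linarith

/-- With `q = ⌈log N⌉` the trace moment bound is effective. -/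
theorem moment_bound_of_sq_log_le {N : ℕ} {T F δ : ℝ} (hF : 0 < F) (hδ : 0 < δ) (hN : 0 < N)
    (hlog : 1 ≤ Real.log N) (h1 : Real.log N ^ 2 ≤ 2 * F / 5 * T)
    (h2 : Real.log N ^ 2 ≤ δ ^ 2 * Real.exp (-2) / (20 * F) * T) :
    1 ≤ F * T ∧ 2 * (N : ℝ) ^ (2 * ⌈Real.log N⌉₊) * Real.exp (-(2 * (F * T))) ≤ 1 ∧
      N * (10 * ⌈Real.log N⌉₊ * (F * T) / (δ * T) ^ 2) ^ ⌈Real.log N⌉₊ ≤ (N : ℝ)⁻¹ := by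
  have hN' : (0 : ℝ) < N := by exact_mod_cast hN
  set ℓ := Real.log N with hℓ
  set q := ⌈ℓ⌉₊ with hq
  have hNe : (N : ℝ) = Real.exp ℓ := (Real.exp_log hN').symm
  have hq1 : ℓ ≤ q := Nat.le_ceil _
  have hq2 : (q : ℝ) ≤ 2 * ℓ := by
    have := Nat.ceil_lt_add_one (by linarith : 0 ≤ ℓ)
    linarith
  have hℓ2 : 1 ≤ ℓ ^ 2 := by nlinarith
  have hT : 0 < T := by
    by_contra hcon
    have : 2 * F / 5 * T ≤ 0 := mul_nonpos_of_nonneg_of_nonpos (by positivity) (not_lt.1 hcon)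
    linarith
  refine ⟨by linarith, ?_, ?_⟩
  · have h2e : (2 : ℝ) ≤ Real.exp 1 := by linarith [Real.add_one_le_exp 1]
    have hpow : (N : ℝ) ^ (2 * q) = Real.exp (2 * q * ℓ) := by
      rw [hNe, ← Real.exp_nat_mul]; push_cast; rfl
    rw [hpow]
    calc _ ≤ Real.exp 1 * Real.exp (2 * q * ℓ) * Real.exp (-(2 * (F * T))) := by gcongr
      _ = Real.exp (1 + 2 * q * ℓ + -(2 * (F * T))) := by rw [Real.exp_add, Real.exp_add]
      _ ≤ 1 := by
        rw [Real.exp_le_one_iff]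
        -- As q ≤ 2ℓ and 1 ≤ ℓ², the positive part 1 + 2qℓ is at most 5ℓ² ≤ 2FT. This fixes the
        -- constant 2F/5.
        nlinarith
  -- The target e⁻² is chosen so that q ≥ ℓ gives N e^(-2q) ≤ 1/N.
  · have hbase : 10 * q * (F * T) / (δ * T) ^ 2 ≤ Real.exp (-2) := by
      rw [div_le_iff₀ (by positivity)]
      have h3 : ℓ ≤ ℓ ^ 2 := by nlinarith
      have h4 : 20 * F * ℓ ^ 2 ≤ δ ^ 2 * Real.exp (-2) * T := by
        have := mul_le_mul_of_nonneg_left h2 (by positivity : 0 ≤ 20 * F)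
        refine this.trans (le_of_eq ?_)
        field_simp
      have h5 : 10 * q * F ≤ 20 * F * ℓ ^ 2 := by
        have : q * F ≤ 2 * ℓ ^ 2 * F := mul_le_mul_of_nonneg_right (by linarith) hF.le
        linarith
      have := mul_le_mul_of_nonneg_right (h5.trans h4) hT.le
      linarith
    calc _ ≤ (N : ℝ) * Real.exp (-2) ^ q := by gcongr
      _ = Real.exp (ℓ + q * (-2)) := by rw [← Real.exp_nat_mul, Real.exp_add, ← hNe]
      _ ≤ Real.exp (-ℓ) := Real.exp_le_exp.2 (by linarith)
      _ = _ := by rw [Real.exp_neg, ← hNe]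

theorem ENNReal.exists_pos_ofReal_le {η : ℝ≥0∞} (hη : 0 < η) :
    ∃ η' : ℝ, 0 < η' ∧ ENNReal.ofReal η' ≤ η := by
  rcases eq_or_ne η ⊤ with rfl | h
  · exact ⟨1, one_pos, le_top⟩
  · exact ⟨η.toReal, ENNReal.toReal_pos hη.ne' h, (ENNReal.ofReal_toReal h).le⟩

/-! ### Criteria for stochastic order and convergence of probabilities -/

section BigO

variable {Ω : Type*} [MeasurableSpace Ω] {P : Measure Ω}

/-- A criterion for `O_p`: uniform bounds for large indices, almost sure bounds for each index. -/
theorem IsBigOInProb.of_eventually {n₀ : ℕ} {Y Z : ℕ → Ω → ℝ}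
    (hsmall : ∀ N, n₀ ≤ N → ∃ C : ℝ, P {ω | C * |Z N ω| < |Y N ω|} = 0)
    (hbig : ∀ η : ℝ, 0 < η → ∃ C : ℝ, ∀ᶠ N in atTop,
      P {ω | C * |Z N ω| < |Y N ω|} ≤ ENNReal.ofReal η) :
    IsBigOInProb P n₀ Y Z := by
  have hmono : ∀ {N : ℕ} {C x : ℝ}, C ≤ x →
      P {ω | x * |Z N ω| < |Y N ω|} ≤ P {ω | C * |Z N ω| < |Y N ω|} := fun hCx =>
    measure_mono fun ω (hω : _ < _) =>
      lt_of_le_of_lt (mul_le_mul_of_nonneg_right hCx (abs_nonneg _)) hω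
  unfold IsBigOInProb
  rw [ENNReal.tendsto_nhds_zero]
  intro η hη
  obtain ⟨η', hη', hη'η⟩ := ENNReal.exists_pos_ofReal_le hη
  obtain ⟨C, hC⟩ := hbig η' hη'
  obtain ⟨N₀, hN₀⟩ := eventually_atTop.1 hC
  -- The supremum runs over all N ≥ n₀, so the finitely many N below N₀ need their own thresholds.
  have hfin : ∀ᶠ x : ℝ in atTop, ∀ N ∈ Finset.range N₀, n₀ ≤ N →
      P {ω | x * |Z N ω| < |Y N ω|} = 0 := by
    rw [Filter.eventually_all_finset]
    intro N _
    by_cases h : n₀ ≤ N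
    · obtain ⟨C', hC'⟩ := hsmall N h
      filter_upwards [eventually_ge_atTop C'] with x hx _
      exact le_antisymm ((hmono hx).trans hC'.le) (zero_le)
    · exact Eventually.of_forall fun x hx => absurd hx h
  filter_upwards [hfin, eventually_ge_atTop C] with x hx hxC
  refine iSup_le fun N => iSup_le fun hN => ?_
  rcases lt_or_ge N N₀ with h | h
  · rw [hx N (Finset.mem_range.2 h) hN]; exact zero_le
  · exact (hmono hxC).trans ((hN₀ N h).trans hη'η)

/-- Subadditivity alone gives 1 ≤ P(S) + P(Sᶜ), so the events need not be shown measurable. -/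
theorem tendsto_measure_one_of_compl [IsProbabilityMeasure P] {S : ℕ → Set Ω}
    (h : ∀ η : ℝ, 0 < η → ∀ᶠ N in atTop, P (S N)ᶜ ≤ ENNReal.ofReal η) :
    Tendsto (fun N => P (S N)) atTop (𝓝 1) := by
  rw [ENNReal.tendsto_nhds ENNReal.one_ne_top]
  intro η hη
  obtain ⟨η', hη', hη'η⟩ := ENNReal.exists_pos_ofReal_le hη
  filter_upwards [h η' hη'] with N hN
  refine ⟨?_, prob_le_one.trans le_self_add⟩
  rw [tsub_le_iff_right]
  calc (1 : ℝ≥0∞) = P (S N ∪ (S N)ᶜ) := by rw [union_compl_self, measure_univ]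
    _ ≤ P (S N) + P (S N)ᶜ := measure_union_le _ _
    _ ≤ _ := add_le_add le_rfl (hN.trans hη'η)

end BigO

/-! ### High-probability noise control and the main theorem -/

section Model

variable {k : ℕ} {f : ℝ → ℝ → ℝ} {θ : Fin k → ℝ} {r : Fin k → ℝ → ℝ}

/-- The noise part of the adjacency matrix satisfies all required bounds with high probability. -/
theorem exists_controlledNoise (hf : IsSpectralKernel f θ r) (hF2 : AssumptionF2 r)
    {ε : ℕ → ℝ} (hε : IsAdmissibleScale f ε) (hE1 : AssumptionE1 ε)
    {Ω : Type*} [MeasurableSpace Ω] {P : Measure Ω} [IsProbabilityMeasure P]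
    {A : (N : ℕ) → Ω → Matrix (Fin N) (Fin N) ℝ}
    (hA : ∀ N, IsInhomERAdjacency P f (ε N) N (A N)) {δ η : ℝ} (hδ : 0 < δ) (hη : 0 < η) :
    ∃ L : ℝ, 0 < L ∧ ∀ᶠ N : ℕ in atTop,
      P {ω | ¬ ∃ W : EuclideanSpace ℝ (Fin N) →ₗ[ℝ] EuclideanSpace ℝ (Fin N),
        W.IsSymmetric ∧ IsControlledNoise W (fun l => discretize (r l) N) δ L (N * ε N) ∧
        ∀ x, Matrix.toEuclideanLin (A N ω) x = (N * ε N) •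
          ∑ l, (θ l * inner ℝ (discretize (r l) N) x) • discretize (r l) N + W x} ≤
        ENNReal.ofReal η := by
  obtain ⟨R, hR0, hR⟩ := hF2.exists_bound
  obtain ⟨F, hF0, hF⟩ := hf.exists_le hF2
  set E₀ := (sSup (image2 f (Icc (0 : ℝ) 1) (Icc (0 : ℝ) 1)))⁻¹ with hE₀
  have hE₀0 : 0 ≤ E₀ := ((hε 1 le_rfl).1.trans_le (hε 1 le_rfl).2).le
  set Q := k * (2 * R ^ 2 * F) + k * k * (2 * R ^ 4 * F * E₀) with hQ
  have hQ0 : 0 ≤ Q := by positivity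
  -- Since L ≥ 1, L² ≥ L ≥ 2Q/η, so the Chebyshev part is at most η/2. The other half is for the
  -- norm bound, of probability at most 1/N.
  set L := 2 * Q / η + 1 with hL
  have hL1 : 1 ≤ L := by
    have : 0 ≤ 2 * Q / η := by positivity
    linarith
  have hQL : Q / L ^ 2 ≤ η / 2 := by
    rw [div_le_iff₀ (by positivity)]
    have h1 : 2 * Q / η ≤ L ^ 2 := by nlinarith
    rw [div_le_iff₀ hη] at h1
    linarith
  refine ⟨L, by linarith, ?_⟩
  have hpos : ∀ N, 1 ≤ N → 0 < ε N := fun N hN => (hε N hN).1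
  filter_upwards [hE1.eventually_sq_log_le hpos (c := 2 * F / 5) (by positivity),
    hE1.eventually_sq_log_le hpos (c := δ ^ 2 * Real.exp (-2) / (20 * F)) (by positivity),
    eventually_ge_atTop 1, (tendsto_natCast_atTop_atTop (R := ℝ)).eventually_ge_atTop (2 / η)]
    with N h1 h2 hN1 hNη
  have hN' : (0 : ℝ) < N := by exact_mod_cast hN1
  obtain ⟨b1, b2, b3⟩ := moment_bound_of_sq_log_le hF0 hδ hN1 h1.1 h1.2 h2.2
  obtain ⟨p, B, hB, hlaw, hp, hdec⟩ := (hA N).exists_noise hf hF (hpos N hN1).le hN1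
  have : IsProbabilityMeasure (P.map B) := Measure.isProbabilityMeasure_map hB.aemeasurable
  have hmain := measureReal_not_isControlledNoise_le (r := r) (q := ⌈Real.log N⌉₊) (δ := δ)
    (L := L) hlaw (fun i x hx => (hR i x hx).1) hp hN1 (hpos N hN1)
    (by linarith) (Nat.ceil_pos.2 (by linarith [h1.1])).ne'
    (by rw [show N * (ε N * F) = F * (N * ε N) by ring]; exact b2) hδ (by linarith)
  rw [show N * (ε N * F) = F * (N * ε N) by ring] at hmain
  have hle : (k * (2 * R ^ 2 * F) + k * k * (2 * R ^ 4 * F * ε N)) / L ^ 2 ≤ Q / L ^ 2 := by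
    have : ε N ≤ E₀ := (hε N hN1).2
    rw [hQ]
    gcongr
  have hNinv : (N : ℝ)⁻¹ ≤ η / 2 := by
    rw [inv_le_comm₀ hN' (by positivity), inv_div]; exact hNη
  set bad : Set (VertexPair N → Bool) := {x | ¬ IsControlledNoise
    (Matrix.toEuclideanLin (bernoulliMatrix p pairMatrix x))
    (fun l => discretize (r l) N) δ L (N * ε N)} with hbad
  calc _ ≤ P (B ⁻¹' bad) := by
        refine measure_mono fun ω hω hcon => hω ⟨_, ?_, hcon, hdec ω⟩
        exact Matrix.isSymmetric_toEuclideanLin_iff.mpr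
          (bernoulliMatrix_isHermitian p pairMatrix_isHermitian _)
    _ = P.map B bad := (Measure.map_apply hB (toFinite _).measurableSet).symm
    _ = ENNReal.ofReal ((P.map B).real bad) := (ofReal_measureReal).symm
    _ ≤ _ := ENNReal.ofReal_le_ofReal (by linarith)

/-- On the event that the noise is under control, the eigenvectors for the `i`-th eigenvalue are
close to the `i`-th discretised eigenfunction. -/
theorem exists_eventually_overlap (hf : IsSpectralKernel f θ r) (hF2 : AssumptionF2 r)
    {ε : ℕ → ℝ} (hε : IsAdmissibleScale f ε) (hE1 : AssumptionE1 ε) {i : Fin k}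
    (hi : IsIsolated θ i) :
    ∃ δ : ℝ, 0 < δ ∧ ∀ L : ℝ, 0 < L → ∃ C : ℝ, 0 < C ∧ ∀ᶠ N : ℕ in atTop, ∃ h : (i : ℕ) < N,
      C / (N * ε N) < 1 ∧
      ∀ (M : Matrix (Fin N) (Fin N) ℝ) (hM : M.IsHermitian)
        (W : EuclideanSpace ℝ (Fin N) →ₗ[ℝ] EuclideanSpace ℝ (Fin N)), W.IsSymmetric →
        IsControlledNoise W (fun l => discretize (r l) N) δ L (N * ε N) →
        (∀ x, Matrix.toEuclideanLin M x = (N * ε N) •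
          ∑ l, (θ l * inner ℝ (discretize (r l) N) x) • discretize (r l) N + W x) →
        ∀ v, IsUnitEigenvector M (orderedEigenvalue hM ⟨i, h⟩) v →
          (∀ j, j ≠ i → |inner ℝ (discretize (r j) N) v| ≤ C / (N * ε N)) ∧
            |inner ℝ (discretize (r i) N) v ^ 2 - 1| ≤ C / (N * ε N) := by
  obtain ⟨R, hR0, hR⟩ := hF2.exists_bound
  have hpos : ∀ N, 1 ≤ N → 0 < ε N := fun N hN => (hε N hN).1
  set E₀ := (sSup (image2 f (Icc (0 : ℝ) 1) (Icc (0 : ℝ) 1)))⁻¹ with hE₀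
  have hE₀0 : 0 ≤ E₀ := ((hε 1 le_rfl).1.trans_le (hε 1 le_rfl).2).le
  -- Monotonicity extends the strict comparison with the two neighbours to all indices.
  have hne : ∀ j, j ≠ i → θ j ≠ θ i := by
    intro j hj
    rcases lt_or_gt_of_ne hj with h | h
    · have hlt : (i : ℕ) - 1 < k := by omega
      have hjle : j ≤ ⟨i - 1, hlt⟩ := by rw [Fin.le_def]; change (j : ℕ) ≤ i - 1; omega
      have h0 : (0 : ℕ) < i := by have : (j : ℕ) < i := h; omega
      exact ((hi.1 ⟨i - 1, hlt⟩ (by simp; omega)).trans_le (hf.antitone hjle)).ne'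
    · have hlt : (i : ℕ) + 1 < k := by have : (i : ℕ) < j := h; omega
      have hjle : (⟨i + 1, hlt⟩ : Fin k) ≤ j := by rw [Fin.le_def]; exact h
      exact ((hf.antitone hjle).trans_lt (hi.2 ⟨i + 1, hlt⟩ rfl)).ne
  obtain ⟨g, hg, hgap⟩ : ∃ g : ℝ, 0 < g ∧ ∀ j, j ≠ i → g ≤ |θ j - θ i| := by
    have h1 : ∀ᶠ g : ℝ in 𝓝[>] 0, ∀ j, j ≠ i → g ≤ |θ j - θ i| := by
      rw [Filter.eventually_all]
      intro j
      by_cases hj : j = i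
      · exact Eventually.of_forall fun _ h => absurd hj h
      · have : 0 < |θ j - θ i| := abs_pos.2 (sub_ne_zero.2 (hne j hj))
        filter_upwards [nhdsWithin_le_nhds (eventually_le_nhds this)] with g hg _
        exact hg
    obtain ⟨g, h2, h3⟩ := (h1.and self_mem_nhdsWithin).exists
    exact ⟨g, h3, h2⟩
  have hθi := hf.pos i
  set a := min g (θ i) with ha
  have ha0 : 0 < a := lt_min hg hθi
  -- The noise and the Gram defect each move λ by at most Ta/4, in total Ta/2. As a ≤ g and a ≤ θ_i,
  -- this leaves gap Tg/2 and λ ≥ Tθ_i/2; moreover a/4 is at most half of κ = θ_i/2.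
  refine ⟨a / 4, by positivity, fun L hL => ?_⟩
  set Θ := ∑ l, θ l with hΘ
  have hΘ0 : 0 ≤ Θ := Finset.sum_nonneg fun l _ => (hf.pos l).le
  obtain ⟨C, hC, hmain⟩ := exists_overlap_bound k (Θ := Θ) (κ := θ i / 2) (g := g / 2) (L := L)
    (c₀ := 2 * R ^ 2 * E₀) hΘ0 (by positivity) (by positivity) hL.le (by positivity)
  refine ⟨C, hC, ?_⟩
  have hηlim : Tendsto (fun N : ℕ => 2 * R ^ 2 / (N : ℝ)) atTop (𝓝 0) :=
    tendsto_const_div_atTop_nhds_zero_nat _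
  have hηlim' : Tendsto (fun N : ℕ => k * (2 * R ^ 2 / (N : ℝ))) atTop (𝓝 0) := by
    simpa using hηlim.const_mul (k : ℝ)
  have hηlim'' : Tendsto (fun N : ℕ => θ i * (k * (2 * R ^ 2 / (N : ℝ)))) atTop (𝓝 0) := by
    simpa using hηlim'.const_mul (θ i)
  filter_upwards [hE1.eventually_sq_log_le hpos one_pos,
    hE1.eventually_sq_log_le hpos (c := 1 / (2 * C)) (by positivity),
    eventually_gt_atTop (i : ℕ), hηlim.eventually_le_const one_pos,
    hηlim'.eventually_lt_const one_pos,
    hηlim''.eventually_le_const (by positivity : 0 < a / 4)] with N h1 h2 hN n1 n2 n3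
  have hN0 : 0 < N := by omega
  have hN' : (0 : ℝ) < N := by exact_mod_cast hN0
  have hT1 : 1 ≤ N * ε N := by nlinarith [h1.1, h1.2]
  have hT0 : 0 < N * ε N := by linarith
  refine ⟨hN, ?_, ?_⟩
  · rw [div_lt_one hT0]
    have : 1 ≤ 1 / (2 * C) * (N * ε N) := by nlinarith [h2.1, h2.2]
    rw [one_div, ← div_eq_inv_mul, le_div_iff₀ (by positivity)] at this
    linarith
  intro M hM W hW hctl hdec v hv
  have he := abs_inner_discretize_sub_le hf hR0 hR hN0
  have hloc := abs_orderedEigenvalue_sub_le hM hdec hT0.le hf.antitone hf.pos he n2 hctl.1 i hN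
  set lam := orderedEigenvalue hM ⟨i, hN⟩ with hlam
  set T := N * ε N with hT
  have hloc' : |lam - T * θ i| ≤ T * (a / 2) :=
    hloc.trans (mul_le_mul_of_nonneg_left (by linarith) hT0.le)
  have hag : a ≤ g := min_le_left _ _
  have haθ : a ≤ θ i := min_le_right _ _
  refine hmain (η := 2 * R ^ 2 / N) (δ := a / 4) (lam := lam) (θ := θ) (W := W)
    (fun x y => hW x y) hv.1 (by rw [← hv.2, hdec]) hT1
    (fun l => ⟨(hf.pos l).le, Finset.single_le_sum (f := θ) (fun l _ => (hf.pos l).le)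
      (Finset.mem_univ l)⟩) ?_ n1 he hctl.1 (by linarith) ?_ hctl.2.1 hctl.2.2 ?_
  -- The Gram defect is O(1/N) and T = Nε, so their product is O(ε), bounded by admissibility of the
  -- scale.
  · calc T * (2 * R ^ 2 / N) = 2 * R ^ 2 * ε N := by rw [hT]; field_simp
      _ ≤ _ := mul_le_mul_of_nonneg_left (hε N hN0).2 (by positivity)
  · have := (abs_le.1 hloc').1
    nlinarith [mul_le_mul_of_nonneg_left haθ hT0.le]
  · intro j hj
    have e1 : T * |θ j - θ i| ≤ |lam - T * θ j| + |lam - T * θ i| := by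
      rw [← abs_of_pos hT0, ← abs_mul, abs_of_pos hT0,
        show T * (θ j - θ i) = (lam - T * θ i) - (lam - T * θ j) by ring]
      exact (abs_sub _ _).trans (add_comm _ _).le
    have e2 := mul_le_mul_of_nonneg_left (hgap j hj) hT0.le
    have e3 := mul_le_mul_of_nonneg_left hag hT0.le
    linarith

end Model

theorem mainTheorem5 {k : ℕ} (f : ℝ → ℝ → ℝ) (θ : Fin k → ℝ) (r : Fin k → ℝ → ℝ)
    (hf : IsSpectralKernel f θ r) (hF2 : AssumptionF2 r)
    (ε : ℕ → ℝ) (hε : IsAdmissibleScale f ε) (hE1 : AssumptionE1 ε)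
    {Ω : Type*} [MeasurableSpace Ω] (P : Measure Ω) [IsProbabilityMeasure P]
    (A : (N : ℕ) → Ω → Matrix (Fin N) (Fin N) ℝ)
    (hA : ∀ N, IsInhomERAdjacency P f (ε N) N (A N))
    (i : Fin k) (hi : IsIsolated θ i) :
    Tendsto (fun N : ℕ => P {ω | ∃ h : (i : ℕ) < N,
        IsSimpleEigenvalue (A N ω) (orderedEigenvalue ((hA N).isHermitian ω) ⟨i, h⟩)})
      atTop (𝓝 1) ∧
    ∀ v : (N : ℕ) → Ω → EuclideanSpace ℝ (Fin N),
      (∀ (N : ℕ) (h : (i : ℕ) < N), ∀ᵐ ω ∂P,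
        IsUnitEigenvector (A N ω) (orderedEigenvalue ((hA N).isHermitian ω) ⟨i, h⟩) (v N ω)) →
      ((∀ N : ℕ, (i : ℕ) < N → ∀ᵐ ω ∂P, 0 ≤ inner ℝ (discretize (r i) N) (v N ω)) →
        IsBigOInProb P ((i : ℕ) + 1)
          (fun N ω => inner ℝ (discretize (r i) N) (v N ω) - 1)
          (fun N _ => (N * ε N)⁻¹)) ∧
      ∀ j : Fin k, j ≠ i →
        IsBigOInProb P ((i : ℕ) + 1)
          (fun N ω => inner ℝ (discretize (r j) N) (v N ω))
          (fun N _ => (N * ε N)⁻¹) := by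
  obtain ⟨δ, hδ, hoverlap⟩ := exists_eventually_overlap hf hF2 hε hE1 hi
  have hTpos : ∀ N, 1 ≤ N → 0 < N * ε N := fun N hN =>
    mul_pos (by exact_mod_cast hN) (hε N hN).1
  refine ⟨tendsto_measure_one_of_compl fun η hη => ?_, fun v hv => ⟨fun hsign => ?_, fun j hj => ?_⟩⟩
  · obtain ⟨L, hL, hnoise⟩ := exists_controlledNoise hf hF2 hε hE1 hA hδ hη
    obtain ⟨C, hC, hov⟩ := hoverlap L hL
    filter_upwards [hnoise, hov] with N h1 ⟨hN, hC1, h2⟩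
    refine (measure_mono fun ω hω => ?_).trans h1
    rintro ⟨W, hW, hctl, hdec⟩
    refine hω ⟨hN, isSimpleEigenvalue_of_inner_ne_zero _ _ (discretize (r i) N) fun w hw h0 => ?_⟩
    have := (h2 _ ((hA N).isHermitian ω) W hW hctl hdec w hw).2
    -- Zero overlap would give 1 ≤ C/T, contrary to C/T < 1.
    rw [h0] at this
    norm_num at this
    linarith
  -- For fixed N, Cauchy–Schwarz bounds the overlap error almost surely by ‖e_i‖ + 1; the factor Nε
  -- cancels the scale.
  · refine IsBigOInProb.of_eventually (fun N hN => ⟨(‖discretize (r i) N‖ + 1) * (N * ε N), ?_⟩)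
      fun η hη => ?_
    · have hT := hTpos N (by omega)
      rw [measure_eq_zero_iff_ae_notMem]
      filter_upwards [hv N hN] with ω hω
      simp only [not_lt]
      rw [abs_of_pos (inv_pos.2 hT), mul_assoc, mul_inv_cancel₀ hT.ne', mul_one]
      refine (abs_sub _ _).trans (add_le_add ?_ (by simp))
      simpa [hω.1] using abs_real_inner_le_norm (discretize (r i) N) (v N ω)
    · obtain ⟨L, hL, hnoise⟩ := exists_controlledNoise hf hF2 hε hE1 hA hδ hη
      obtain ⟨C, hC, hov⟩ := hoverlap L hL
      refine ⟨C, ?_⟩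
      filter_upwards [hnoise, hov] with N h1 ⟨hN, _, h2⟩
      have hT := hTpos N (by omega)
      refine (measure_mono_ae ?_).trans h1
      filter_upwards [hv N hN, hsign N hN] with ω hω hs hlt
      rintro ⟨W, hW, hctl, hdec⟩
      have h3 := (h2 _ ((hA N).isHermitian ω) W hW hctl hdec _ hω).2
      replace hlt : C * |(N * ε N)⁻¹| < |inner ℝ (discretize (r i) N) (v N ω) - 1| := hlt
      rw [abs_of_pos (inv_pos.2 hT), ← div_eq_mul_inv] at hlt
      refine absurd (hlt.trans_le (le_trans ?_ h3)) (lt_irrefl _)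
      -- The sign convention makes c_i + 1 ≥ 1, so |c_i - 1| ≤ |c_i² - 1|.
      rw [show inner ℝ (discretize (r i) N) (v N ω) ^ 2 - 1 =
        (inner ℝ (discretize (r i) N) (v N ω) - 1) * (inner ℝ (discretize (r i) N) (v N ω) + 1) by
        ring, abs_mul, abs_of_nonneg (by linarith : 0 ≤ inner ℝ (discretize (r i) N) (v N ω) + 1)]
      exact le_mul_of_one_le_right (abs_nonneg _) (by linarith)
  · refine IsBigOInProb.of_eventually (fun N hN => ⟨‖discretize (r j) N‖ * (N * ε N), ?_⟩)
      fun η hη => ?_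
    · have hT := hTpos N (by omega)
      rw [measure_eq_zero_iff_ae_notMem]
      filter_upwards [hv N hN] with ω hω
      simp only [not_lt]
      rw [abs_of_pos (inv_pos.2 hT), mul_assoc, mul_inv_cancel₀ hT.ne', mul_one]
      simpa [hω.1] using abs_real_inner_le_norm (discretize (r j) N) (v N ω)
    · obtain ⟨L, hL, hnoise⟩ := exists_controlledNoise hf hF2 hε hE1 hA hδ hη
      obtain ⟨C, hC, hov⟩ := hoverlap L hL
      refine ⟨C, ?_⟩
      filter_upwards [hnoise, hov] with N h1 ⟨hN, _, h2⟩
      have hT := hTpos N (by omega)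
      refine (measure_mono_ae ?_).trans h1
      filter_upwards [hv N hN] with ω hω hlt
      rintro ⟨W, hW, hctl, hdec⟩
      have h3 := (h2 _ ((hA N).isHermitian ω) W hW hctl hdec _ hω).1 j hj
      replace hlt : C * |(N * ε N)⁻¹| < |inner ℝ (discretize (r j) N) (v N ω)| := hlt
      rw [abs_of_pos (inv_pos.2 hT), ← div_eq_mul_inv] at hlt
      exact absurd (hlt.trans_le h3) (lt_irrefl _)
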